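/- Let $n\ge 1$, let $G=Sp_{2n}(\mathbb R)$ be the group of real matrices $\begin{bmatrix}A&B\\C&D\end{bmatrix}$ with $n\times n$ blocks satisfying $A^tD-C^tB=I_n$, $A^tC=C^tA$, $B^tD=D^tB$, let $P_J^+\subset G$ be the subgroup given by $C=0$, and let $\mathcal P=G/P_J^+$ be the Lagrangian Grassmannian, with its Hausdorff (quotient) topology; the coset of such a matrix is written $\begin{bmatrix}A\\C\end{bmatrix}$ (the span of its first $n$ columns). Put $$\mathcal P_{>0}=\left\{\begin{bmatrix}I_n\\C\end{bmatrix}: C\text{ symmetric positive definite}\right\},\qquad \mathcal P_{\ge0}=\left\{\begin{bmatrix}A\\C\end{bmatrix}\in\mathcal P: A^tC\text{ symmetric positive semidefinite}\right\}.$$ Let $T\subset G$ be the diagonal torus, $B^+$ the Borel subgroup given by $C=0$ and $A$ upper triangular, $B^-$ the one given by $B=0$ and $A$ lower triangular. Let $e_i=E_{i,i+1}-E_{n+i+1,n+i}$ for $1\le i\le n-1$, $e_n=E_{n,2n}$, $x_i(a)=\exp(ae_i)$ and $y_i(a)=\exp(ae_i^t)$. For signs $\epsilon_i\in\{\pm1\}$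 with $\epsilon_n=1$ put $x_{i,\epsilon_i}(a)=x_i(\epsilon_ia)$, $y_{i,\epsilon_i}(a)=y_i(\epsilon_ia)$, and let $$\mathrm C=\{(T,B^+,B^-,x_{i,\epsilon_i},y_{i,\epsilon_i};1\le i\le n)\mid \epsilon_i\in\{\pm1\}\text{ for }i\ne n,\ \epsilon_n=1\}.$$ For a pinning $\mathbf P=(T,B^+,B^-,x_i',y_i')\in\mathrm C$, let $U^+_{(\mathbf P,>0)}$ (resp. $U^-_{(\mathbf P,>0)}$) be the set of products $x'_{i_1}(a_1)\cdots x'_{i_k}(a_k)$ (resp. $y'_{i_1}(a_1)\cdots y'_{i_k}(a_k)$) with all $a_j>0$ and $(i_1,\dots,i_k)$ a reduced word for the longest element of the Weyl group of type $C_n$. Let $T_{>0}$ be the subgroup generated by all $\chi(c)$ with $\chi$ a cocharacter of $T$ and $c>0$. Let $G_{(\mathbf P,>0)}=U^-_{(\mathbf P,>0)}T_{>0}U^+_{(\mathbf P,>0)}$, and let $G_{(\mathbf P,\ge0)}$ be the submonoid of $G$ generated by all $x_i'(a)$, $y_i'(b)$, $\chi(c)$ with $a,b,c>0$. Put $$\mathcal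 P_{(\mathbf P,>0)}=G_{(\mathbf P,>0)}\cdot P_J^+,\qquad \mathcal P_{(\mathbf P,\ge0)}=\overline{G_{(\mathbf P,\ge0)}\cdot P_J^+}\subseteq\mathcal P.$$ Then the sets $\mathcal P_{(\mathbf P,>0)}$, $\mathbf P\in\mathrm C$, are pairwise disjoint, and $$\bigsqcup_{\mathbf P\in\mathrm C}\mathcal P_{(\mathbf P,>0)}\subseteq\mathcal P_{>0},\qquad \bigcup_{\mathbf P\in\mathrm C}\mathcal P_{(\mathbf P,\ge0)}\subseteq\mathcal P_{\ge0}.$$ The first inclusion is strict whenever $n\ge2$. The second inclusion is an equality for $n=2$ and is not an equality for any $n\ge3$. -/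

import Mathlib

open Matrix

noncomputable section

namespace LagGr

/-- The real symplectic group `Sp_{2n}(ℝ)`; a `2n × 2n` matrix is indexed by `Fin n ⊕ Fin n`,
so that it has four `n × n` blocks `A`, `B`, `C`, `D`. It carries the topology of a space
of real matrices. -/
abbrev Sp (n : ℕ) : Type := symplecticGroup (Fin n) ℝ

variable {n : ℕ}

/-- The upper left block. -/
def blockA (g : Sp n) : Matrix (Fin n) (Fin n) ℝ := g.1.toBlocks₁₁
/-- The upper right block. -/
def blockB (g : Sp n) : Matrix (Fin n) (Fin n) ℝ := g.1.toBlocks₁₂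
/-- The lower left block. -/
def blockC (g : Sp n) : Matrix (Fin n) (Fin n) ℝ := g.1.toBlocks₂₁
/-- The lower right block. -/
def blockD (g : Sp n) : Matrix (Fin n) (Fin n) ℝ := g.1.toBlocks₂₂

theorem coe_eq_fromBlocks (g : Sp n) :
    g.1 = fromBlocks (blockA g) (blockB g) (blockC g) (blockD g) :=
  (fromBlocks_toBlocks _).symm

theorem coe_mul_eq (g h : Sp n) : (g * h).1 =
    fromBlocks (blockA g * blockA h + blockB g * blockC h)
      (blockA g * blockB h + blockB g * blockD h)
      (blockC g * blockA h + blockD g * blockC h)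
      (blockC g * blockB h + blockD g * blockD h) := by
  rw [Submonoid.coe_mul, coe_eq_fromBlocks g, coe_eq_fromBlocks h, fromBlocks_multiply]

theorem coe_inv_eq (g : Sp n) : (g⁻¹).1 =
    fromBlocks (blockD g)ᵀ (-(blockB g)ᵀ) (-(blockC g)ᵀ) (blockA g)ᵀ := by
  rw [SymplecticGroup.coe_inv, coe_eq_fromBlocks g, J, fromBlocks_transpose, fromBlocks_neg,
    fromBlocks_multiply, fromBlocks_multiply]
  simp

theorem blockA_mul (g h : Sp n) :
    blockA (g * h) = blockA g * blockA h + blockB g * blockC h := by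
  simp [blockA, coe_mul_eq g h]

theorem blockB_mul (g h : Sp n) :
    blockB (g * h) = blockA g * blockB h + blockB g * blockD h := by
  simp [blockB, coe_mul_eq g h]

theorem blockC_mul (g h : Sp n) :
    blockC (g * h) = blockC g * blockA h + blockD g * blockC h := by
  simp [blockC, coe_mul_eq g h]

theorem blockD_mul (g h : Sp n) :
    blockD (g * h) = blockC g * blockB h + blockD g * blockD h := by
  simp [blockD, coe_mul_eq g h]

theorem blockA_inv (g : Sp n) : blockA g⁻¹ = (blockD g)ᵀ := by simp [blockA, coe_inv_eq g]
theorem blockB_inv (g : Sp n) : blockB g⁻¹ = -(blockB g)ᵀ := by simp [blockB, coe_inv_eq g]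
theorem blockC_inv (g : Sp n) : blockC g⁻¹ = -(blockC g)ᵀ := by simp [blockC, coe_inv_eq g]
theorem blockD_inv (g : Sp n) : blockD g⁻¹ = (blockA g)ᵀ := by simp [blockD, coe_inv_eq g]

theorem blockA_one : blockA (1 : Sp n) = 1 := by
  ext i j; simp [blockA, toBlocks₁₁, one_apply]
theorem blockB_one : blockB (1 : Sp n) = 0 := by
  ext i j; simp [blockB, toBlocks₁₂]
theorem blockC_one : blockC (1 : Sp n) = 0 := by
  ext i j; simp [blockC, toBlocks₂₁]
theorem blockD_one : blockD (1 : Sp n) = 1 := by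
  ext i j; simp [blockD, toBlocks₂₂, one_apply]

/-- The defining relation `AᵀD - CᵀB = 1`. -/
theorem block_relation (g : Sp n) : (blockA g)ᵀ * blockD g - (blockC g)ᵀ * blockB g = 1 := by
  have h := g.2
  rw [coe_eq_fromBlocks g, SymplecticGroup.fromBlocks_mem_iff] at h
  exact h.2.2

/-! ### The maximal torus, the Borel subgroups and the Siegel parabolic subgroup -/

/-- The maximal torus `T` of diagonal symplectic matrices. -/
def torus (n : ℕ) : Subgroup (Sp n) where
  carrier := {g | g.1.IsDiag}
  one_mem' := by
    show IsDiag (1 : Matrix _ _ ℝ)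
    exact isDiag_one
  mul_mem' := by
    intro a b ha hb
    show IsDiag (a.1 * b.1)
    rw [← (isDiag_iff_diagonal_diag _).1 ha, ← (isDiag_iff_diagonal_diag _).1 hb,
      diagonal_mul_diagonal]
    exact isDiag_diagonal _
  inv_mem' := by
    intro a ha
    have ha' : a.1.IsDiag := ha
    show IsDiag (a⁻¹).1
    rw [coe_eq_fromBlocks a] at ha'
    rw [coe_inv_eq]
    rw [isDiag_fromBlocks_iff] at ha' ⊢
    obtain ⟨h1, h2, h3, h4⟩ := ha'
    exact ⟨h4.transpose, by simp [h2], by simp [h3], h1.transpose⟩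

/-- The Borel subgroup `B⁺`: `C = 0` and `A` upper triangular (then `D = (Aᵀ)⁻¹`). -/
def borelPlus (n : ℕ) : Subgroup (Sp n) where
  carrier := {g | blockC g = 0 ∧ (blockA g).BlockTriangular id}
  one_mem' := ⟨blockC_one, by rw [blockA_one]; exact blockTriangular_one⟩
  mul_mem' := by
    rintro a b ⟨ha, ha'⟩ ⟨hb, hb'⟩
    refine ⟨by rw [blockC_mul, ha, hb]; simp, ?_⟩
    rw [blockA_mul, hb, Matrix.mul_zero, add_zero]
    exact ha'.mul hb'
  inv_mem' := by
    rintro a ⟨ha, ha'⟩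
    refine ⟨by rw [blockC_inv, ha]; simp, ?_⟩
    have h := block_relation a
    rw [ha, Matrix.transpose_zero, Matrix.zero_mul, sub_zero] at h
    have h2 : (blockD a)ᵀ * blockA a = 1 := by
      have := congrArg Matrix.transpose h
      simpa using this
    let _ : Invertible (blockA a) := invertibleOfLeftInverse _ _ h2
    rw [blockA_inv, ← inv_eq_left_inv h2]
    exact blockTriangular_inv_of_blockTriangular ha'

/-- The opposite Borel subgroup `B⁻`: `B = 0` and `A` lower triangular. -/
def borelMinus (n : ℕ) : Subgroup (Sp n) where
  carrier := {g | blockB g = 0 ∧ (blockA g)ᵀ.BlockTriangular id}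
  one_mem' := ⟨blockB_one, by
    rw [blockA_one, Matrix.transpose_one]; exact blockTriangular_one⟩
  mul_mem' := by
    rintro a b ⟨ha, ha'⟩ ⟨hb, hb'⟩
    refine ⟨by rw [blockB_mul, ha, hb]; simp, ?_⟩
    rw [blockA_mul, ha, Matrix.zero_mul, add_zero, Matrix.transpose_mul]
    exact hb'.mul ha'
  inv_mem' := by
    rintro a ⟨ha, ha'⟩
    refine ⟨by rw [blockB_inv, ha]; simp, ?_⟩
    have h := block_relation a
    rw [ha, Matrix.mul_zero, sub_zero] at h
    let _ : Invertible (blockA a)ᵀ := invertibleOfRightInverse _ _ h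
    rw [blockA_inv, Matrix.transpose_transpose, ← inv_eq_right_inv h]
    exact blockTriangular_inv_of_blockTriangular ha'

/-- The parabolic subgroup `P_J⁺` for `J = {1, …, n-1}`: the matrices with `C = 0`. -/
def parabolic (n : ℕ) : Subgroup (Sp n) where
  carrier := {g | blockC g = 0}
  one_mem' := blockC_one
  mul_mem' := by
    intro a b ha hb
    have ha' : blockC a = 0 := ha
    have hb' : blockC b = 0 := hb
    show blockC (a * b) = 0
    rw [blockC_mul, ha', hb']; simp
  inv_mem' := by
    intro a ha
    have ha' : blockC a = 0 := ha
    show blockC a⁻¹ = 0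
    rw [blockC_inv, ha']; simp

/-- The Lagrangian Grassmannian `𝒫 = Sp_{2n}(ℝ) / P_J⁺`, with the quotient topology. The coset
of `g` is the Lagrangian subspace spanned by the first `n` columns of `g`. -/
abbrev LG (n : ℕ) : Type := Sp n ⧸ parabolic n

/-- For a subset `S` of the group, the subset `S · P_J⁺` of `𝒫`. -/
def orbit (S : Set (Sp n)) : Set (LG n) := (QuotientGroup.mk : Sp n → LG n) '' S

/-! ### The theta positive and theta nonnegative parts -/

/-- The theta positive unipotent semigroup `U⁻_{J,>0}`: the matrices `[[1, 0], [C, 1]]`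
with `C` symmetric positive definite. -/
def thetaUnipotent (n : ℕ) : Set (Sp n) :=
  {g | ∃ C : Matrix (Fin n) (Fin n) ℝ, C.PosDef ∧ g.1 = fromBlocks 1 0 C 1}

/-- The theta positive part `𝒫_{>0} = U⁻_{J,>0} · P_J⁺`. -/
def thetaPos (n : ℕ) : Set (LG n) := orbit (thetaUnipotent n)

/-- The theta nonnegative part `𝒫_{≥0}`: the points `[A; C]` with `AᵀC` (symmetric) positive
semidefinite. -/
def thetaNonneg (n : ℕ) : Set (LG n) :=
  orbit {g | ((blockA g)ᵀ * blockC g).PosSemidef}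

/-! ### The Weyl group of type `C_n` and reduced words for its longest element -/

/-- The simple reflections as signed permutations, where `inl k` stands for `k` and `inr k`
for `-k`: `s_i` exchanges `±i` and `±(i+1)` for `i < n`, and `s_n` exchanges `n` and `-n`. -/
def simpleReflection (i : Fin n) : Equiv.Perm (Fin n ⊕ Fin n) :=
  if h : i.val + 1 < n then
    Equiv.swap (Sum.inl i) (Sum.inl ⟨i.val + 1, h⟩) *
      Equiv.swap (Sum.inr i) (Sum.inr ⟨i.val + 1, h⟩)
  else Equiv.swap (Sum.inl i) (Sum.inr i)

/-- The Weyl group element expressed by a word in the simple reflections. -/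
def wordProd (ω : List (Fin n)) : Equiv.Perm (Fin n ⊕ Fin n) :=
  (ω.map simpleReflection).prod

/-- A word is reduced if no shorter word expresses the same element. -/
def IsReducedWord (ω : List (Fin n)) : Prop :=
  ∀ ω' : List (Fin n), wordProd ω' = wordProd ω → ω.length ≤ ω'.length

/-- A reduced word for the longest element of the Weyl group. -/
def IsLongestWord (ω : List (Fin n)) : Prop :=
  IsReducedWord ω ∧ ∀ ω' : List (Fin n), IsReducedWord ω' → ω'.length ≤ ω.length

/-! ### Pinnings and the totally positive and totally nonnegative parts -/

/-- The tuple of data `(T, B⁺, B⁻, x_i, y_i)` that makes up a pinning. -/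
structure PinningData (n : ℕ) where
  T : Subgroup (Sp n)
  Bplus : Subgroup (Sp n)
  Bminus : Subgroup (Sp n)
  x : Fin n → ℝ → Sp n
  y : Fin n → ℝ → Sp n

/-- A cocharacter of `T`: a homomorphism `ℝˣ → T` whose matrix entries are Laurent
polynomials. -/
def IsCocharacter (T : Subgroup (Sp n)) (χ : ℝˣ →* Sp n) : Prop :=
  (∀ c, χ c ∈ T) ∧ ∀ k l, ∃ p : LaurentPolynomial ℝ, ∀ c : ℝˣ,
    (χ c).1 k l = LaurentPolynomial.eval₂ (RingHom.id ℝ) c p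

/-- The elements `χ(c)`, for `χ` a cocharacter of `T` and `c > 0`. -/
def cocharValues (T : Subgroup (Sp n)) : Set (Sp n) :=
  {t | ∃ χ : ℝˣ →* Sp n, IsCocharacter T χ ∧ ∃ c : ℝˣ, 0 < (c : ℝ) ∧ t = χ c}

namespace PinningData

variable (P : PinningData n)

/-- `T_{>0}`. -/
def torusPos : Subgroup (Sp n) := Subgroup.closure (cocharValues P.T)

/-- `U⁺_{>0}`: the products `x_{i_1}(a_1) ⋯ x_{i_k}(a_k)` with all `a_j > 0`, for
`(i_1, …, i_k)` a reduced word of the longest element. -/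
def unipotentPlusPos : Set (Sp n) :=
  {u | ∃ ω : List (Fin n × ℝ), IsLongestWord (ω.map Prod.fst) ∧ (∀ p ∈ ω, 0 < p.2) ∧
    u = (ω.map fun p => P.x p.1 p.2).prod}

/-- `U⁻_{>0}`: the products `y_{i_1}(b_1) ⋯ y_{i_k}(b_k)` with all `b_j > 0`, for
`(i_1, …, i_k)` a reduced word of the longest element. -/
def unipotentMinusPos : Set (Sp n) :=
  {u | ∃ ω : List (Fin n × ℝ), IsLongestWord (ω.map Prod.fst) ∧ (∀ p ∈ ω, 0 < p.2) ∧
    u = (ω.map fun p => P.y p.1 p.2).prod}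

/-- The totally positive part `U⁻_{>0} T_{>0} U⁺_{>0}` of the group. -/
def groupPos : Set (Sp n) :=
  {g | ∃ u ∈ P.unipotentMinusPos, ∃ t ∈ P.torusPos, ∃ v ∈ P.unipotentPlusPos, g = u * t * v}

/-- The totally nonnegative part of the group: the submonoid generated by all `x_i(a)`,
`y_i(b)`, `χ(c)` with `a, b, c > 0`. -/
def groupNonneg : Submonoid (Sp n) :=
  Submonoid.closure ({g | ∃ i, ∃ a : ℝ, 0 < a ∧ g = P.x i a} ∪
    {g | ∃ i, ∃ b : ℝ, 0 < b ∧ g = P.y i b} ∪ cocharValues P.T)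

/-- The totally positive part `𝒫_{(P,>0)}` of the Lagrangian Grassmannian. -/
def totPos : Set (LG n) := orbit P.groupPos

/-- The totally nonnegative part `𝒫_{(P,≥0)}` of the Lagrangian Grassmannian. -/
def totNonneg : Set (LG n) := closure (orbit (P.groupNonneg : Set (Sp n)))

end PinningData

/-! ### The standard pinning and its sign changes -/

/-- The Chevalley generators: `e_i = E_{i,i+1} - E_{n+i+1,n+i}` for `i < n`, and
`e_n = E_{n,2n}`. -/
def chevalleyE (i : Fin n) : Matrix (Fin n ⊕ Fin n) (Fin n ⊕ Fin n) ℝ :=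
  if h : i.val + 1 < n then
    fromBlocks (single i ⟨i.val + 1, h⟩ 1) 0 0 (-single ⟨i.val + 1, h⟩ i 1)
  else fromBlocks 0 (single i i 1) 0 0

theorem one_add_chevalleyE_mem (i : Fin n) (a : ℝ) :
    1 + a • chevalleyE i ∈ symplecticGroup (Fin n) ℝ := by
  unfold chevalleyE
  split_ifs with h
  · have hne : (⟨i.val + 1, h⟩ : Fin n) ≠ i := by
      intro e
      have := congrArg Fin.val e
      simp at this
    rw [← fromBlocks_one, fromBlocks_smul, fromBlocks_add, SymplecticGroup.fromBlocks_mem_iff]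
    refine ⟨by simp, by simp, ?_⟩
    simp [Matrix.add_mul, Matrix.mul_add, hne.symm]
  · rw [← fromBlocks_one, fromBlocks_smul, fromBlocks_add, SymplecticGroup.fromBlocks_mem_iff]
    refine ⟨by simp, by simp, by simp⟩

/-- `x_i(a) = exp(a e_i) = 1 + a e_i`, as `e_i² = 0`. -/
def xStd (i : Fin n) (a : ℝ) : Sp n := ⟨1 + a • chevalleyE i, one_add_chevalleyE_mem i a⟩

/-- `y_i(a) = exp(a f_i)` with `f_i = e_iᵀ`, that is, the transpose of `x_i(a)`. -/
def yStd (i : Fin n) (a : ℝ) : Sp n :=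
  ⟨(xStd i a).1ᵀ, SymplecticGroup.transpose_mem (xStd i a).2⟩

/-- The standard pinning changed by the signs `ε_i`:
`x_{i,ε_i}(a) = x_i(ε_i a)` and `y_{i,ε_i}(a) = y_i(ε_i a)`. -/
def signedPinning (ε : Fin n → ℤˣ) : PinningData n where
  T := torus n
  Bplus := borelPlus n
  Bminus := borelMinus n
  x i a := xStd i (((ε i : ℤ) : ℝ) * a)
  y i a := yStd i (((ε i : ℤ) : ℝ) * a)

/-- The family `C` of the pinnings with arbitrary signs `ε_i` for `i ≠ n`, and `ε_n = 1`. -/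
def pinningFamily (n : ℕ) : Set (PinningData n) :=
  {P | ∃ ε : Fin n → ℤˣ, (∀ i : Fin n, i.val + 1 = n → ε i = 1) ∧ P = signedPinning ε}

end LagGr

end

/-! The factors in T_{>0} and U⁺ fix the base point, so a totally positive point is given by a
product of the `y_i` along a reduced word of the longest element. Such a product spans the graph of
a symmetric matrix S. Prepending `y_i` with i < n changes S by an elementary congruence; prepending
`y_n` adds a positive multiple of E_{nn}. Hence S stays positive semidefinite, and after conjugation
by the diagonal signs `lowerSign ε` its entries stay nonnegative. Following indices through the word
shows that for the longest element S has no kernel and no zero entry (`exists_isPositiveAlong`). So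
S is positive definite, and the sign of S_{i,i+1} is -ε_i, which recovers the pinning and gives
disjointness. The identity matrix has zero entries off the diagonal, so it is missed when n ≥ 2.

The condition that AᵀC be positive semidefinite is closed, invariant under P_J⁺ and preserved by all
generators, which gives the second inclusion. For n = 2, positive definite graphs are dense in
𝒫_{≥0} (`thetaNonneg_subset_closure_thetaPos`), and one with nonzero off-diagonal entry q is an
explicit product of three `y_i`, the sign ε_1 being opposite to that of q.

For n ≥ 3 the obstruction comes from Plücker coordinates. In the order 1 < ⋯ < n < -n < ⋯ < -1 and
after a sign change of the basis, the generators other than those of the torus are products of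
transvections with positive coefficients between adjacent rows, so all Plücker coordinates of a
totally nonnegative point have one common weak sign. For a graph this makes the signs in each column
of S agree with those of `lowerSign ε` up to a factor (`lowerUnipotent_mem_pluckerSet`). The
semidefinite matrix n·1 minus the all-ones matrix violates this as soon as there are three indices.
-/

open Matrix

noncomputable section

namespace LagGr

variable {n : ℕ}

/-! ### Signed permutations, the exchange condition and the longest element -/

/-- The position of a signed index in the ordering `1 < ⋯ < n < -n < ⋯ < -1`; the signed indices
`1, …, n` have negative positions. -/
def position (x : Fin n ⊕ Fin n) : ℤ :=
  Sum.elim (fun k : Fin n => (k : ℤ) - n) (fun k : Fin n => (n : ℤ) - 1 - k) x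

@[simp] theorem position_inl (k : Fin n) :
    position (Sum.inl k : Fin n ⊕ Fin n) = (k : ℤ) - n := rfl

@[simp] theorem position_inr (k : Fin n) :
    position (Sum.inr k : Fin n ⊕ Fin n) = (n : ℤ) - 1 - k := rfl

theorem position_swap (x : Fin n ⊕ Fin n) : position x.swap = -1 - position x := by
  rcases x with k | k <;> simp <;> ring

theorem position_injective : Function.Injective (position : Fin n ⊕ Fin n → ℤ) := by
  rintro (k | k) (l | l) h <;> simp only [position_inl, position_inr] at h
  · congr 1; ext; omega
  · omega
  · omega
  · congr 1; ext; omega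

/-- The signed index that follows `i` in the ordering `1 < ⋯ < n < -n < ⋯ < -1`. -/
def next (i : Fin n) : Fin n ⊕ Fin n :=
  if h : i.val + 1 < n then Sum.inl ⟨i.val + 1, h⟩ else Sum.inr i

theorem next_of_lt {i : Fin n} (h : i.val + 1 < n) : next i = Sum.inl ⟨i.val + 1, h⟩ := dif_pos h

theorem next_of_not_lt {i : Fin n} (h : ¬ i.val + 1 < n) : next i = Sum.inr i := dif_neg h

/-- The reflection exchanging the signed indices `p` and `q`, and `-p` and `-q`. -/
def reflection (p q : Fin n ⊕ Fin n) : Equiv.Perm (Fin n ⊕ Fin n) :=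
  if q = p.swap then Equiv.swap p q else Equiv.swap p q * Equiv.swap p.swap q.swap

theorem simpleReflection_eq_reflection (i : Fin n) :
    simpleReflection i = reflection (Sum.inl i) (next i) := by
  by_cases h : i.val + 1 < n
  · simp [simpleReflection, reflection, next_of_lt h, h]
  · simp [simpleReflection, reflection, next_of_not_lt h, h]

theorem reflection_swap_swap {p q : Fin n ⊕ Fin n} (hpq : p ≠ q) :
    reflection q.swap p.swap = reflection p q := by
  by_cases h : q = p.swap
  · subst h; simp [reflection]
  · have h' : ¬ p.swap = q := fun e => h e.symm
    have hs : p.swap ≠ q.swap := fun e => hpq (by simpa using congrArg Sum.swap e)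
    have hp : ¬ p.swap = p := by rcases p with k | k <;> simp
    have hq : ¬ q.swap = q := by rcases q with k | k <;> simp
    have h2 : q.swap ≠ p := fun e => h (by rw [← e, Sum.swap_swap])
    have hd : Equiv.Perm.Disjoint (Equiv.swap p q) (Equiv.swap p.swap q.swap) := by
      rw [Equiv.Perm.disjoint_iff_disjoint_support, Equiv.Perm.support_swap hpq,
        Equiv.Perm.support_swap hs]
      simp [hp, hq, h2, h']
    simp only [reflection, Sum.swap_swap, h, h', if_false]
    rw [Equiv.swap_comm q p, Equiv.swap_comm q.swap p.swap, hd.commute.eq]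

/-- Conjugation by a permutation that commutes with the sign change carries reflections to
reflections. The exchange condition uses this to move a reflection past a letter. -/
theorem mul_reflection {u : Equiv.Perm (Fin n ⊕ Fin n)} (hu : ∀ x, u x.swap = (u x).swap)
    (p q : Fin n ⊕ Fin n) : u * reflection p q = reflection (u p) (u q) * u := by
  have key : (u q = (u p).swap) ↔ q = p.swap := by rw [← hu]; exact u.injective.eq_iff
  by_cases h : q = p.swap
  · subst h
    simp only [reflection, hu, if_true]
    rw [Equiv.mul_swap_eq_swap_mul, hu]
  · simp only [reflection, key, h, if_false]
    rw [← mul_assoc, Equiv.mul_swap_eq_swap_mul u p q, mul_assoc,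
      Equiv.mul_swap_eq_swap_mul u p.swap q.swap, hu, hu, mul_assoc]

theorem simpleReflection_inl_of_lt {i : Fin n} (h : i.val + 1 < n) (k : Fin n) :
    simpleReflection i (Sum.inl k) = Sum.inl (Equiv.swap i ⟨i.val + 1, h⟩ k) := by
  simp only [simpleReflection, h, dif_pos, Equiv.Perm.mul_apply, Equiv.swap_apply_def,
    reduceCtorEq, if_false, Sum.inl.injEq]
  split_ifs <;> rfl

theorem simpleReflection_inr_of_lt {i : Fin n} (h : i.val + 1 < n) (k : Fin n) :
    simpleReflection i (Sum.inr k) = Sum.inr (Equiv.swap i ⟨i.val + 1, h⟩ k) := by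
  simp only [simpleReflection, h, dif_pos, Equiv.Perm.mul_apply, Equiv.swap_apply_def,
    Sum.inr.injEq]
  split_ifs <;> simp_all

theorem simpleReflection_of_not_lt {i : Fin n} (h : ¬ i.val + 1 < n) :
    simpleReflection i = Equiv.swap (Sum.inl i) (Sum.inr i) := dif_neg h

theorem simpleReflection_mul_self (i : Fin n) : simpleReflection i * simpleReflection i = 1 := by
  by_cases h : i.val + 1 < n
  · ext (k | k) : 1
    · simp [simpleReflection_inl_of_lt h]
    · simp [simpleReflection_inr_of_lt h]
  · simp [simpleReflection_of_not_lt h]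

theorem simpleReflection_inv (i : Fin n) : (simpleReflection i)⁻¹ = simpleReflection i :=
  inv_eq_of_mul_eq_one_right (simpleReflection_mul_self i)

theorem simpleReflection_apply_apply (i : Fin n) (x : Fin n ⊕ Fin n) :
    simpleReflection i (simpleReflection i x) = x := by
  rw [← Equiv.Perm.mul_apply, simpleReflection_mul_self, Equiv.Perm.one_apply]

theorem simpleReflection_apply_swap (i : Fin n) (x : Fin n ⊕ Fin n) :
    simpleReflection i x.swap = (simpleReflection i x).swap := by
  by_cases h : i.val + 1 < n
  · rcases x with k | k <;> simp [simpleReflection_inl_of_lt h, simpleReflection_inr_of_lt h]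
  · rw [simpleReflection_of_not_lt h]
    rcases x with k | k <;> by_cases hk : k = i <;> simp [Equiv.swap_apply_def, hk]

theorem simpleReflection_inl_self (i : Fin n) : simpleReflection i (Sum.inl i) = next i := by
  by_cases h : i.val + 1 < n
  · simp [simpleReflection_inl_of_lt h, next_of_lt h]
  · simp [simpleReflection_of_not_lt h, next_of_not_lt h]

theorem simpleReflection_next (i : Fin n) : simpleReflection i (next i) = Sum.inl i := by
  rw [← simpleReflection_inl_self, simpleReflection_apply_apply]

theorem position_lt_next (i : Fin n) :
    position (Sum.inl i : Fin n ⊕ Fin n) < position (next i) := by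
  by_cases h : i.val + 1 < n
  · simp [next_of_lt h]
  · simp [next_of_not_lt h]; omega

theorem inl_ne_next (i : Fin n) : Sum.inl i ≠ next i := fun e =>
  (position_lt_next i).ne (congrArg position e)

/-- A simple reflection reverses the order of its own pair only. -/
theorem reflection_eq_simpleReflection {j : Fin n} {p q : Fin n ⊕ Fin n}
    (hpq : position p < position q)
    (h : position (simpleReflection j q) < position (simpleReflection j p)) :
    reflection p q = simpleReflection j := by
  have key : (p = Sum.inl j ∧ q = next j) ∨ (p = (next j).swap ∧ q = Sum.inr j) := by
    by_cases hj : j.val + 1 < n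
    · rcases p with k | k <;> rcases q with l | l <;>
        simp only [simpleReflection_inl_of_lt hj, simpleReflection_inr_of_lt hj, position_inl,
          position_inr, Equiv.swap_apply_def, next_of_lt hj, Sum.swap_inl, reduceCtorEq,
          Sum.inl.injEq, Sum.inr.injEq, Fin.ext_iff, false_and, and_false, or_false,
          false_or] at h hpq ⊢ <;>
        split_ifs at h <;> (try simp only at h) <;> omega
    · rcases p with k | k <;> rcases q with l | l <;>
        simp only [simpleReflection_of_not_lt hj, Equiv.swap_apply_def, next_of_not_lt hj,
          Sum.inl.injEq, Sum.inr.injEq, reduceCtorEq, if_false, Sum.swap_inr] at h ⊢ <;>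
        simp only [position_inl, position_inr] at hpq <;>
        split_ifs at h <;> simp only [position_inl, position_inr] at h <;>
        simp only [Fin.ext_iff, false_and, and_false, or_false] at * <;>
        omega
  rcases key with ⟨rfl, rfl⟩ | ⟨rfl, rfl⟩
  · rw [simpleReflection_eq_reflection]
  · rw [simpleReflection_eq_reflection, ← reflection_swap_swap (inl_ne_next j), Sum.swap_inl]

theorem wordProd_cons (i : Fin n) (ω : List (Fin n)) :
    wordProd (i :: ω) = simpleReflection i * wordProd ω := by simp [wordProd]

theorem wordProd_cons_inv_apply (i : Fin n) (ω : List (Fin n)) (x : Fin n ⊕ Fin n) :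
    (wordProd (i :: ω))⁻¹ x = (wordProd ω)⁻¹ (simpleReflection i x) := by
  rw [wordProd_cons, _root_.mul_inv_rev, simpleReflection_inv, Equiv.Perm.mul_apply]

theorem wordProd_inv_apply_swap (ω : List (Fin n)) (x : Fin n ⊕ Fin n) :
    (wordProd ω)⁻¹ x.swap = ((wordProd ω)⁻¹ x).swap := by
  induction ω generalizing x with
  | nil => simp [wordProd]
  | cons i ω ih => rw [wordProd_cons_inv_apply, wordProd_cons_inv_apply,
      simpleReflection_apply_swap, ih]

/-- The exchange condition. -/
theorem exists_wordProd_eq_reflection_mul (ω : List (Fin n)) {p q : Fin n ⊕ Fin n}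
    (hpq : position p < position q)
    (h : position ((wordProd ω)⁻¹ q) < position ((wordProd ω)⁻¹ p)) :
    ∃ ω' : List (Fin n), ω'.length + 1 = ω.length ∧
      wordProd ω' = reflection p q * wordProd ω := by
  induction ω generalizing p q with
  | nil => simp [wordProd] at h; omega
  | cons j ω ih =>
    rw [wordProd_cons_inv_apply, wordProd_cons_inv_apply] at h
    -- Either the first letter keeps the order of the pair and the reflection moves past it, or it
    -- reverses the pair, so that it is the reflection itself and cancels.
    rcases lt_or_ge (position (simpleReflection j p)) (position (simpleReflection j q)) with h1 | h1
    · obtain ⟨ω', hl, hω'⟩ := ih h1 h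
      refine ⟨j :: ω', by simp [hl], ?_⟩
      rw [wordProd_cons, hω', wordProd_cons, ← mul_assoc,
        mul_reflection (simpleReflection_apply_swap j), simpleReflection_apply_apply,
        simpleReflection_apply_apply, mul_assoc]
    · have h2 : position (simpleReflection j q) ≠ position (simpleReflection j p) := fun e =>
        hpq.ne' (congrArg position ((simpleReflection j).injective (position_injective e)))
      refine ⟨ω, by simp, ?_⟩
      rw [reflection_eq_simpleReflection hpq (lt_of_le_of_ne h1 h2), wordProd_cons, ← mul_assoc,
        simpleReflection_mul_self, one_mul]

theorem IsReducedWord.of_cons {i : Fin n} {ω : List (Fin n)} (h : IsReducedWord (i :: ω)) :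
    IsReducedWord ω := fun ω' hω' => by
  simpa using h (i :: ω') (by rw [wordProd_cons, wordProd_cons, hω'])

/-- Otherwise the exchange condition gives a word for the same element that is shorter than `i ::
ω`. -/
theorem IsReducedWord.position_lt {i : Fin n} {ω : List (Fin n)} (h : IsReducedWord (i :: ω)) :
    position ((wordProd ω)⁻¹ (Sum.inl i)) < position ((wordProd ω)⁻¹ (next i)) := by
  by_contra hc
  have hne : position ((wordProd ω)⁻¹ (next i)) ≠ position ((wordProd ω)⁻¹ (Sum.inl i)) := fun e =>
    inl_ne_next i ((wordProd ω)⁻¹.injective (position_injective e)).symm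
  obtain ⟨ω', hl, hω'⟩ := exists_wordProd_eq_reflection_mul ω (position_lt_next i)
    (lt_of_le_of_ne (not_lt.1 hc) hne)
  rw [← simpleReflection_eq_reflection, ← wordProd_cons] at hω'
  have := h ω' hω'
  simp at this
  omega

theorem IsReducedWord.cons {i : Fin n} {ω : List (Fin n)} (h : IsReducedWord ω)
    (hi : position ((wordProd ω)⁻¹ (Sum.inl i)) < position ((wordProd ω)⁻¹ (next i))) :
    IsReducedWord (i :: ω) := by
  -- Any word `ω'` for the longer product reverses the pair `i`, `next i`, so the exchange condition
  -- removes one of its letters and leaves a word for `wordProd ω`.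
  intro ω' hω'
  rw [← simpleReflection_next i, ← wordProd_cons_inv_apply, ← hω'] at hi
  nth_rewrite 2 [← simpleReflection_inl_self i] at hi
  rw [← wordProd_cons_inv_apply, ← hω'] at hi
  obtain ⟨ω'', hl, hω''⟩ := exists_wordProd_eq_reflection_mul ω' (position_lt_next i) hi
  have := h ω'' (by rw [hω'', hω', wordProd_cons, ← simpleReflection_eq_reflection, ← mul_assoc,
    simpleReflection_mul_self, one_mul])
  simp
  omega

/-- No letter can be prepended to a longest word, so the inverse permutation reverses every pair of
neighbours. The claim holds at the last index by symmetry under sign change and then descends. -/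
theorem IsLongestWord.position_nonneg {ω : List (Fin n)} (h : IsLongestWord ω) (k : Fin n) :
    0 ≤ position ((wordProd ω)⁻¹ (Sum.inl k)) := by
  have hd : ∀ i : Fin n,
      position ((wordProd ω)⁻¹ (next i)) ≤ position ((wordProd ω)⁻¹ (Sum.inl i)) := by
    intro i
    by_contra hc
    have := h.2 _ (h.1.cons (not_le.1 hc))
    simp at this
  obtain ⟨m, hm⟩ : ∃ m, m + k.val + 1 = n := ⟨n - k.val - 1, by omega⟩
  induction m generalizing k with
  | zero =>
    -- At the last index the neighbour is the negative of `k`, so the position p satisfies -1 - p ≤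
    -- p, and p ≥ 0 because it is an integer.
    have := hd k
    rw [next_of_not_lt (by omega), ← Sum.swap_inl, wordProd_inv_apply_swap, position_swap] at this
    omega
  | succ m ih =>
    have hk : k.val + 1 < n := by omega
    have := hd k
    rw [next_of_lt hk] at this
    exact (ih ⟨k.val + 1, hk⟩ (by simp; omega)).trans this

/-! ### Generators in block form, and signs -/

theorem coe_xStd_of_lt {i : Fin n} (h : i.val + 1 < n) (a : ℝ) : (xStd i a).1 =
    fromBlocks (transvection i ⟨i.val + 1, h⟩ a) 0 0 (transvection ⟨i.val + 1, h⟩ i (-a)) := by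
  simp [xStd, chevalleyE, h, ← fromBlocks_one, fromBlocks_smul, fromBlocks_add, transvection,
    ← single_neg]

theorem coe_xStd_of_not_lt {i : Fin n} (h : ¬ i.val + 1 < n) (a : ℝ) : (xStd i a).1 =
    fromBlocks 1 (single i i a) 0 1 := by
  simp [xStd, chevalleyE, h, ← fromBlocks_one, fromBlocks_smul, fromBlocks_add]

theorem transvection_transpose {ι : Type*} [DecidableEq ι] (i j : ι) (a : ℝ) :
    (transvection i j a)ᵀ = transvection j i a := by
  simp [transvection]

theorem coe_yStd_of_lt {i : Fin n} (h : i.val + 1 < n) (a : ℝ) : (yStd i a).1 =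
    fromBlocks (transvection ⟨i.val + 1, h⟩ i a) 0 0 (transvection i ⟨i.val + 1, h⟩ (-a)) := by
  simp [yStd, coe_xStd_of_lt h, fromBlocks_transpose, transvection_transpose]

theorem coe_yStd_of_not_lt {i : Fin n} (h : ¬ i.val + 1 < n) (a : ℝ) : (yStd i a).1 =
    fromBlocks 1 0 (single i i a) 1 := by
  simp [yStd, coe_xStd_of_not_lt h, fromBlocks_transpose]

theorem blocks_of_coe_eq {g : Sp n} {A B C D : Matrix (Fin n) (Fin n) ℝ}
    (h : g.1 = fromBlocks A B C D) :
    blockA g = A ∧ blockB g = B ∧ blockC g = C ∧ blockD g = D := by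
  simp [blockA, blockB, blockC, blockD, h]

/-- The sign `ε_1 ⋯ ε_k`. -/
def cumSign (ε : Fin n → ℤˣ) (k : ℕ) : ℝ :=
  ∏ j ∈ Finset.range k, if h : j < n then ((ε ⟨j, h⟩ : ℤ) : ℝ) else 1

theorem sign_mul_self (u : ℤˣ) : ((u : ℤ) : ℝ) * ((u : ℤ) : ℝ) = 1 := by
  rcases Int.units_eq_one_or u with h | h <;> simp [h]

theorem cumSign_succ (ε : Fin n → ℤˣ) (i : Fin n) :
    cumSign ε (i.val + 1) = cumSign ε i * ((ε i : ℤ) : ℝ) := by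
  simp [cumSign, Finset.prod_range_succ]

theorem cumSign_mul_self (ε : Fin n → ℤˣ) (k : ℕ) : cumSign ε k * cumSign ε k = 1 := by
  rw [cumSign, ← Finset.prod_mul_distrib]
  refine Finset.prod_eq_one fun j _ => ?_
  split_ifs
  · exact sign_mul_self _
  · simp

/-- The sign of the signed index `-k` for the signs `ε`. -/
def lowerSign (ε : Fin n → ℤˣ) (k : ℕ) : ℝ := (-1) ^ (n + 1 + k) * cumSign ε k

theorem lowerSign_mul_self (ε : Fin n → ℤˣ) (k : ℕ) : lowerSign ε k * lowerSign ε k = 1 := by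
  rw [lowerSign, mul_mul_mul_comm, cumSign_mul_self, ← mul_pow]; simp

/-- The extra minus sign compensates the one in the lower block of `e_i`. -/
theorem lowerSign_succ (ε : Fin n → ℤˣ) (i : Fin n) :
    lowerSign ε (i.val + 1) = -(lowerSign ε i * ((ε i : ℤ) : ℝ)) := by
  rw [lowerSign, cumSign_succ, lowerSign]; ring

/-! ### Positivity along a reduced word -/

/-- The least `k` such that a tail `k, k + 1, …, n` of the alphabet is found as a subsequence of
the word by greedy search from its end. -/
def subwordStart : List (Fin n) → ℕ
  | [] => n
  | i :: ω => if i.val + 1 = subwordStart ω then i else subwordStart ω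

theorem subwordStart_cons_le (i : Fin n) (ω : List (Fin n)) :
    subwordStart (i :: ω) ≤ subwordStart ω := by
  rw [subwordStart]; split_ifs <;> omega

/-- To become negative, an index must be carried up to `n` by letters that include `k, k + 1, …` in
this order, and then be flipped by the letter `n`. This is a subsequence of the word, so the greedy
search reaches at least as far. -/
theorem subwordStart_le (ω : List (Fin n)) {k : Fin n}
    (hk : 0 ≤ position ((wordProd ω)⁻¹ (Sum.inl k))) : subwordStart ω ≤ k := by
  induction ω generalizing k with
  | nil => simp [wordProd] at hk; omega
  | cons i ω ih =>
    rw [wordProd_cons_inv_apply] at hk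
    rw [subwordStart]
    by_cases hi : i.val + 1 < n
    · rw [simpleReflection_inl_of_lt hi, Equiv.swap_apply_def] at hk
      split_ifs at hk with h1 h2
      · have := ih hk
        subst h1
        simp only at this
        split_ifs <;> omega
      · have := ih hk
        subst h2
        simp only
        split_ifs <;> omega
      · have := ih hk
        split_ifs <;> omega
    · by_cases hk' : k = i
      · subst hk'
        split_ifs with h1
        · exact le_rfl
        · have hle : ∀ ω : List (Fin n), subwordStart ω ≤ n := by
            intro ω
            induction ω with
            | nil => exact le_rfl
            | cons i ω ih => exact (subwordStart_cons_le i ω).trans ih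
          have := hle ω
          omega
      · rw [simpleReflection_of_not_lt hi, Equiv.swap_apply_of_ne_of_ne (by simp [hk']) (by simp)]
          at hk
        have := ih hk
        split_ifs <;> omega

/-- The properties of the symmetric matrix `S` for which a product of the `y_i(a)`, `a > 0`, along
the reduced word `ω` spans the graph of `S`. -/
structure IsPositiveAlong (ε : Fin n → ℤˣ) (ω : List (Fin n)) (S : Matrix (Fin n) (Fin n) ℝ) :
    Prop where
  posSemidef : S.PosSemidef
  nonneg : ∀ k l : Fin n, 0 ≤ lowerSign ε k * S k l * lowerSign ε l
  pos : ∀ k l : Fin n, subwordStart ω ≤ k → subwordStart ω ≤ l →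
    0 < lowerSign ε k * S k l * lowerSign ε l
  ker : ∀ x : Fin n → ℝ, S *ᵥ x = 0 → ∀ j, x j ≠ 0 → (∀ k, j < k → x k = 0) →
    position ((wordProd ω)⁻¹ (Sum.inl j)) < 0

theorem isPositiveAlong_nil (ε : Fin n → ℤˣ) : IsPositiveAlong ε [] 0 where
  posSemidef := PosSemidef.zero
  nonneg := by simp
  pos k l hk _ := by simp [subwordStart] at hk; omega
  ker x _ j _ _ := by simp [wordProd]

theorem conj_transvection_apply (i j : Fin n) (c : ℝ) (S : Matrix (Fin n) (Fin n) ℝ)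
    (k l : Fin n) :
    (transvection i j c * S * transvection j i c : Matrix (Fin n) (Fin n) ℝ) k l =
      S k l + (if k = i then c * S j l else 0) + (if l = i then c * S k j else 0)
        + if k = i ∧ l = i then c * c * S j j else 0 := by
  by_cases hk : k = i <;> by_cases hl : l = i
  · subst hk hl
    simp [mul_transvection_apply_same, transvection_mul_apply_same]; ring
  · subst hk
    simp [mul_transvection_apply_of_ne, transvection_mul_apply_same, hl]
  · subst hl
    simp [mul_transvection_apply_same, transvection_mul_apply_of_ne, hk]
  · simp [mul_transvection_apply_of_ne, transvection_mul_apply_of_ne, hk, hl]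

theorem IsPositiveAlong.cons_of_lt {ε : Fin n → ℤˣ} {ω : List (Fin n)}
    {S : Matrix (Fin n) (Fin n) ℝ} (hS : IsPositiveAlong ε ω S) {i : Fin n} (hi : i.val + 1 < n)
    (hω : IsReducedWord (i :: ω)) {a : ℝ} (ha : 0 < a) :
    IsPositiveAlong ε (i :: ω)
      (transvection i ⟨i.val + 1, hi⟩ (-(((ε i : ℤ) : ℝ) * a)) * S *
        transvection ⟨i.val + 1, hi⟩ i (-(((ε i : ℤ) : ℝ) * a))) := by
  set i' : Fin n := ⟨i.val + 1, hi⟩ with hi'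
  have hne : i ≠ i' := by simp [hi', Fin.ext_iff]
  have hii' : i < i' := by simp [hi', Fin.lt_def]
  have hle : ∀ k, k < i' → k ≤ i := fun k hk => by
    rw [hi'] at hk; exact Nat.lt_succ_iff.1 hk
  have hge : ∀ k, i < k → i' ≤ k := fun k hk => by rw [hi']; exact hk
  have hval : i'.val = i.val + 1 := by rw [hi']
  have hnext : next i = Sum.inl i' := by rw [hi', next_of_lt hi]
  -- This relation makes the coefficient of the congruence positive after the sign change: row and
  -- column `i` receive `a` times row and column `i'`.
  have hcs : lowerSign ε i * -(((ε i : ℤ) : ℝ) * a) = lowerSign ε i' * a := by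
    rw [hi', lowerSign_succ]; ring
  have hc0 : -(((ε i : ℤ) : ℝ) * a) ≠ 0 := by
    intro h0
    have := sign_mul_self (ε i)
    rcases mul_eq_zero.1 (neg_eq_zero.1 h0) with h | h
    · simp [h] at this
    · exact ha.ne' h
  generalize -(((ε i : ℤ) : ℝ) * a) = c at hcs hc0 ⊢
  clear_value i'
  have entry : ∀ k l : Fin n, lowerSign ε k * (transvection i i' c * S *
      transvection i' i c : Matrix (Fin n) (Fin n) ℝ) k l * lowerSign ε l = lowerSign ε k * S k l * lowerSign ε l
      + (if k = i then a * (lowerSign ε i' * S i' l * lowerSign ε l) else 0)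
      + (if l = i then a * (lowerSign ε k * S k i' * lowerSign ε i') else 0)
      + if k = i ∧ l = i then a * a * (lowerSign ε i' * S i' i' * lowerSign ε i') else 0 := by
    intro k l
    rw [conj_transvection_apply]
    by_cases hk : k = i <;> by_cases hl : l = i <;> simp only [hk, hl, if_true, if_false,
      and_self, and_false, false_and]
    · linear_combination (S i' i * lowerSign ε i + S i i' * lowerSign ε i +
        S i' i' * (c * lowerSign ε i + lowerSign ε i' * a)) * hcs
    · linear_combination (S i' l * lowerSign ε l) * hcs
    · linear_combination (S k i' * lowerSign ε k) * hcs
    · ring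
  have nn : ∀ k l : Fin n, ∀ p : Prop, [Decidable p] → ∀ b : ℝ, 0 ≤ b →
      0 ≤ if p then b * (lowerSign ε k * S k l * lowerSign ε l) else 0 := by
    intro k l p _ b hb
    split_ifs
    · exact mul_nonneg hb (hS.nonneg k l)
    · exact le_rfl
  refine ⟨?_, ?_, ?_, ?_⟩
  · simpa [transvection_transpose] using
      hS.posSemidef.mul_mul_conjTranspose_same (transvection i i' c)
  · intro k l
    rw [entry]
    have := hS.nonneg k l
    have := nn i' l (k = i) a ha.le
    have := nn k i' (l = i) a ha.le
    have := nn i' i' (k = i ∧ l = i) (a * a) (mul_self_nonneg a)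
    linarith
  · intro k l hk hl
    rw [entry]
    have h1 := hS.nonneg k l
    have h2 := nn i' l (k = i) a ha.le
    have h3 := nn k i' (l = i) a ha.le
    have h4 := nn i' i' (k = i ∧ l = i) (a * a) (mul_self_nonneg a)
    -- If the block of positive entries grows, its new row and column `i` are fed by row and column
    -- `i'`, which already lie in the block.
    by_cases hr : subwordStart ω ≤ k ∧ subwordStart ω ≤ l
    · have := hS.pos k l hr.1 hr.2
      linarith
    · have hstart : i.val + 1 = subwordStart ω := by
        by_contra hcon
        rw [subwordStart, if_neg hcon] at hk hl
        exact hr ⟨hk, hl⟩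
      rw [subwordStart, if_pos hstart] at hk hl
      have hi'ω : subwordStart ω ≤ i' := by rw [hval]; exact hstart.ge
      rcases eq_or_lt_of_le hk with hk | hk <;> rcases eq_or_lt_of_le hl with hl | hl
      · have hk := Fin.ext hk.symm
        have hl := Fin.ext hl.symm
        have hkl : k = i ∧ l = i := ⟨hk, hl⟩
        simp only [hkl, and_self, if_true] at h1 h2 h3 h4 ⊢
        have := mul_pos (mul_pos ha ha) (hS.pos i' i' hi'ω hi'ω)
        linarith
      · have hk := Fin.ext hk.symm
        rw [if_pos hk] at h2 ⊢
        have := mul_pos ha (hS.pos i' l hi'ω (by omega))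
        linarith
      · have hl := Fin.ext hl.symm
        rw [if_pos hl] at h3 ⊢
        have := mul_pos ha (hS.pos k i' (by omega) hi'ω)
        linarith
      · exact absurd ⟨by omega, by omega⟩ hr
  -- A kernel vector x of the new matrix gives the kernel vector y of `S` that differs from x only
  -- in the coordinate `i'`, by `c * x i`. The last nonzero coordinate can thus change only between
  -- `i` and `i'`, in step with the simple reflection.
  · intro x hx j hj hjk
    have hinv : (transvection i i' (-c) * transvection i i' c : Matrix (Fin n) (Fin n) ℝ) = 1 := by
      rw [transvection_mul_transvection_same _ _ hne, neg_add_cancel, transvection_zero]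
    have hy : S *ᵥ (transvection i' i c *ᵥ x) = 0 := by
      have := congrArg (fun v => transvection i i' (-c) *ᵥ v) hx
      simpa only [Matrix.mulVec_mulVec, ← Matrix.mul_assoc, hinv, Matrix.one_mul,
        Matrix.mulVec_zero] using this
    set y := transvection i' i c *ᵥ x with hyd
    have hyk : ∀ k, y k = x k + if k = i' then c * x i else 0 := by
      intro k
      rw [hyd, transvection, Matrix.add_mulVec, one_mulVec, single_mulVec_eq, Pi.add_apply]
      by_cases hk : k = i' <;> simp [hk]
    rw [wordProd_cons_inv_apply, simpleReflection_inl_of_lt hi, Equiv.swap_apply_def]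
    rw [← hi']
    split_ifs with h1 h2
    · subst h1
      refine hS.ker y hy i' ?_ ?_
      · rw [hyk, if_pos rfl, hjk i' hii']
        simpa using ⟨hc0, hj⟩
      · intro k hk
        rw [hyk, if_neg hk.ne', hjk k (hii'.trans hk), add_zero]
    -- When x ends at `i'`, the vector y may still end there. The index to be controlled is now `i`,
    -- and reducedness bounds its position by that of `i'`.
    · have hred := hω.position_lt
      rw [hnext] at hred
      rw [h2] at hj hjk
      by_cases hy0 : y i' = 0
      · refine hS.ker y hy i ?_ ?_
        · rw [hyk, if_neg hne, add_zero]
          intro hxi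
          rw [hyk, if_pos rfl, hxi] at hy0
          simp [hj] at hy0
        · intro k hk
          by_cases hk' : k = i'
          · rw [hk', hy0]
          · rw [hyk, if_neg hk', add_zero]
            exact hjk k (lt_of_le_of_ne (hge k hk) (Ne.symm hk'))
      · refine hred.trans (hS.ker y hy i' hy0 ?_)
        intro k hk
        rw [hyk, if_neg hk.ne', hjk k hk, add_zero]
    · refine hS.ker y hy j ?_ ?_
      · rw [hyk, if_neg h2, add_zero]; exact hj
      · intro k hk
        rw [hyk, hjk k hk]
        split_ifs with h3
        · have : j < i := lt_of_le_of_ne (hle j (h3 ▸ hk)) h1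
          simp [hjk i this]
        · simp

theorem posSemidef_single (i : Fin n) {a : ℝ} (ha : 0 ≤ a) :
    (single i i a : Matrix (Fin n) (Fin n) ℝ).PosSemidef := by
  rw [← diagonal_single]
  exact PosSemidef.diagonal (Pi.single_nonneg.2 ha)

theorem IsPositiveAlong.cons_of_not_lt {ε : Fin n → ℤˣ} {ω : List (Fin n)}
    {S : Matrix (Fin n) (Fin n) ℝ} (hS : IsPositiveAlong ε ω S) {i : Fin n} (hi : ¬ i.val + 1 < n)
    {a : ℝ} (ha : 0 < a) : IsPositiveAlong ε (i :: ω) (S + single i i a) := by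
  have entry : ∀ k l : Fin n, lowerSign ε k * (S + single i i a : Matrix (Fin n) (Fin n) ℝ) k l * lowerSign ε l =
      lowerSign ε k * S k l * lowerSign ε l + if k = i ∧ l = i then a else 0 := by
    intro k l
    by_cases h : k = i ∧ l = i
    · obtain ⟨rfl, rfl⟩ := h
      simp
      linear_combination a * lowerSign_mul_self ε _
    · have : ¬ (i = k ∧ i = l) := fun h' => h ⟨h'.1.symm, h'.2.symm⟩
      simp [h, this]
  refine ⟨hS.posSemidef.add (posSemidef_single i ha.le), ?_, ?_, ?_⟩
  · intro k l
    rw [entry]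
    exact add_nonneg (hS.nonneg k l) (by split_ifs <;> [exact ha.le; exact le_rfl])
  · intro k l hk hl
    rw [entry]
    rw [subwordStart] at hk hl
    split_ifs at hk hl with hr
    · rw [if_pos ⟨Fin.ext (by omega), Fin.ext (by omega)⟩]
      exact add_pos_of_nonneg_of_pos (hS.nonneg k l) ha
    · exact add_pos_of_pos_of_nonneg (hS.pos k l hk hl)
        (by split_ifs <;> [exact ha.le; exact le_rfl])
  · intro x hx j hj hjk
    -- Both summands of the quadratic form are nonnegative, so both vanish. Thus x lies in the
    -- kernel of `S` and its last coordinate is zero, so the letter does not move `j`.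
    have hq : x ⬝ᵥ (S *ᵥ x) + a * (x i * x i) = 0 := by
      have := congrArg (fun v => x ⬝ᵥ v) hx
      simp only [Matrix.add_mulVec, dotProduct_add, dotProduct_zero, single_mulVec_eq, dotProduct_smul,
        dotProduct_single, smul_eq_mul] at this
      linarith
    have hnn : 0 ≤ x ⬝ᵥ (S *ᵥ x) := by simpa using hS.posSemidef.dotProduct_mulVec_nonneg x
    have hxi : x i = 0 := by
      have : x i * x i ≤ 0 := by
        by_contra hcon
        have := mul_pos ha (not_le.1 hcon)
        linarith
      nlinarith
    have hSx : S *ᵥ x = 0 := by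
      rw [Matrix.add_mulVec, single_mulVec_eq, hxi] at hx
      simpa using hx
    have hji : j ≠ i := fun e => hj (by rw [e, hxi])
    rw [wordProd_cons_inv_apply, simpleReflection_of_not_lt hi,
      Equiv.swap_apply_of_ne_of_ne (by simpa using hji) (by simp)]
    exact hS.ker x hSx j hj hjk

/-- A product of the `y_i(a)`, `a > 0`, along a reduced word spans a graph. -/
theorem exists_isPositiveAlong (ε : Fin n → ℤˣ) (hε : ∀ i : Fin n, i.val + 1 = n → ε i = 1)
    (l : List (Fin n × ℝ)) (hl : IsReducedWord (l.map Prod.fst)) (hpos : ∀ p ∈ l, 0 < p.2) :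
    ∃ S, IsPositiveAlong ε (l.map Prod.fst) S ∧
      blockC (l.map fun p => (signedPinning ε).y p.1 p.2).prod =
        S * blockA (l.map fun p => (signedPinning ε).y p.1 p.2).prod := by
  induction l with
  | nil => exact ⟨0, isPositiveAlong_nil ε, by simp [blockC_one]⟩
  | cons p l ih =>
    obtain ⟨i, a⟩ := p
    obtain ⟨S, hS, hg⟩ := ih (by simpa using IsReducedWord.of_cons hl)
      fun p hp => hpos p (List.mem_cons_of_mem _ hp)
    have ha : 0 < a := hpos (i, a) List.mem_cons_self
    set g := (l.map fun p => (signedPinning ε).y p.1 p.2).prod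
    rw [List.map_cons, List.map_cons, List.prod_cons, blockC_mul, blockA_mul, hg]
    change ∃ S', IsPositiveAlong ε _ S' ∧ blockC (yStd i (((ε i : ℤ) : ℝ) * a)) * _ +
      blockD (yStd i (((ε i : ℤ) : ℝ) * a)) * _ =
      S' * (blockA (yStd i (((ε i : ℤ) : ℝ) * a)) * _ + blockB (yStd i (((ε i : ℤ) : ℝ) * a)) * _)
    by_cases hi : i.val + 1 < n
    · refine ⟨_, hS.cons_of_lt hi hl ha, ?_⟩
      obtain ⟨h1, h2, h3, h4⟩ := blocks_of_coe_eq (coe_yStd_of_lt hi (((ε i : ℤ) : ℝ) * a))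
      rw [h1, h2, h3, h4]
      have hne : (⟨i.val + 1, hi⟩ : Fin n) ≠ i := by simp [Fin.ext_iff]
      generalize ((ε i : ℤ) : ℝ) * a = c
      simp only [Matrix.zero_mul, zero_add, add_zero]
      rw [← Matrix.mul_assoc _ (transvection _ _ c), Matrix.mul_assoc _ _ (transvection _ _ c),
        transvection_mul_transvection_same _ _ hne, neg_add_cancel, transvection_zero,
        Matrix.mul_one, Matrix.mul_assoc]
    · refine ⟨_, hS.cons_of_not_lt hi ha, ?_⟩
      obtain ⟨h1, h2, h3, h4⟩ := blocks_of_coe_eq (coe_yStd_of_not_lt hi (((ε i : ℤ) : ℝ) * a))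
      rw [h1, h2, h3, h4, hε i (by omega)]
      simp only [Matrix.zero_mul, add_zero, Matrix.add_mul, Units.val_one,
        Int.cast_one, one_mul]
      exact add_comm _ _

/-! ### Graphs of symmetric matrices and the totally positive parts -/

/-- The element `[[1, 0], [S, 1]]` of the symplectic group. -/
def lowerUnipotent (S : Matrix (Fin n) (Fin n) ℝ) (hS : Sᵀ = S) : Sp n :=
  ⟨fromBlocks 1 0 S 1, by rw [SymplecticGroup.fromBlocks_mem_iff]; simp [hS]⟩

/-- The element `[[1, S], [0, 1]]` of the symplectic group. -/
def upperUnipotent (S : Matrix (Fin n) (Fin n) ℝ) (hS : Sᵀ = S) : Sp n :=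
  ⟨fromBlocks 1 S 0 1, by rw [SymplecticGroup.fromBlocks_mem_iff]; simp [hS]⟩

theorem mk_eq_mk_iff (g h : Sp n) : (g : LG n) = (h : LG n) ↔
    (blockA g)ᵀ * blockC h = (blockC g)ᵀ * blockA h := by
  rw [QuotientGroup.eq]
  change blockC (g⁻¹ * h) = 0 ↔ _
  rw [blockC_mul, blockC_inv, blockD_inv, Matrix.neg_mul, neg_add_eq_zero, eq_comm]

theorem mk_lowerUnipotent_eq_iff (S : Matrix (Fin n) (Fin n) ℝ) (hS : Sᵀ = S) (g : Sp n) :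
    (lowerUnipotent S hS : LG n) = (g : LG n) ↔ blockC g = S * blockA g := by
  obtain ⟨h1, h2, h3, h4⟩ := blocks_of_coe_eq (g := lowerUnipotent S hS) rfl
  rw [mk_eq_mk_iff, h1, h3, hS]
  simp

theorem mk_lowerUnipotent_injective {S S' : Matrix (Fin n) (Fin n) ℝ} {hS : Sᵀ = S}
    {hS' : S'ᵀ = S'} (h : (lowerUnipotent S hS : LG n) = (lowerUnipotent S' hS' : LG n)) :
    S = S' := by
  rw [mk_lowerUnipotent_eq_iff] at h
  obtain ⟨h1, h2, h3, h4⟩ := blocks_of_coe_eq (g := lowerUnipotent S' hS') rfl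
  rw [h1, h3, Matrix.mul_one] at h
  exact h.symm

theorem mk_lowerUnipotent_mem_thetaPos {S : Matrix (Fin n) (Fin n) ℝ} (hS : Sᵀ = S)
    (h : S.PosDef) : (lowerUnipotent S hS : LG n) ∈ thetaPos n := ⟨_, ⟨S, h, rfl⟩, rfl⟩

theorem torus_le_parabolic : torus n ≤ parabolic n := by
  intro g hg
  have hg' : g.1.IsDiag := hg
  ext i j
  exact hg' (by simp)

theorem xStd_mem_parabolic (i : Fin n) (a : ℝ) : xStd i a ∈ parabolic n := by
  change blockC _ = 0
  by_cases hi : i.val + 1 < n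
  · exact (blocks_of_coe_eq (coe_xStd_of_lt hi a)).2.2.1
  · exact (blocks_of_coe_eq (coe_xStd_of_not_lt hi a)).2.2.1

theorem cocharValues_subset (T : Subgroup (Sp n)) : cocharValues T ⊆ T := by
  rintro _ ⟨χ, hχ, c, -, rfl⟩
  exact hχ.1 c

theorem exists_of_mem_totPos {ε : Fin n → ℤˣ} (hε : ∀ i : Fin n, i.val + 1 = n → ε i = 1)
    {x : LG n} (hx : x ∈ (signedPinning ε).totPos) :
    ∃ (S : Matrix (Fin n) (Fin n) ℝ) (hS : Sᵀ = S), S.PosDef ∧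
      (∀ k l : Fin n, 0 < lowerSign ε k * S k l * lowerSign ε l) ∧
      x = (lowerUnipotent S hS : LG n) := by
  obtain ⟨_, ⟨u, ⟨l, hl, hpos, rfl⟩, t, ht, v, ⟨l', -, -, rfl⟩, rfl⟩, rfl⟩ := hx
  have ht' : t ∈ parabolic n := (Subgroup.closure_le _).2
    ((cocharValues_subset _).trans torus_le_parabolic) ht
  have hv : (l'.map fun p => (signedPinning ε).x p.1 p.2).prod ∈ parabolic n := by
    refine Subgroup.list_prod_mem _ fun x hx => ?_
    obtain ⟨p, -, rfl⟩ := List.mem_map.1 hx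
    exact xStd_mem_parabolic _ _
  obtain ⟨S, hS, hg⟩ := exists_isPositiveAlong ε hε l hl.1 hpos
  have hsym : Sᵀ = S := by simpa using hS.posSemidef.isHermitian.eq
  have hzero : subwordStart (l.map Prod.fst) = 0 ∨ n = 0 := by
    rcases Nat.eq_zero_or_pos n with h | h
    · exact Or.inr h
    · exact Or.inl (Nat.le_zero.1 (subwordStart_le _ (hl.position_nonneg ⟨0, h⟩)))
  refine ⟨S, hsym, ?_, ?_, ?_⟩
  · rw [posDef_iff_dotProduct_mulVec]
    refine ⟨hS.posSemidef.isHermitian, fun x hx => ?_⟩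
    refine lt_of_le_of_ne (hS.posSemidef.dotProduct_mulVec_nonneg x) fun h0 => hx ?_
    have hker := (hS.posSemidef.dotProduct_mulVec_zero_iff x).1 h0.symm
    by_contra hx0
    -- The last nonzero coordinate of a kernel vector would have to keep a negative position, but
    -- the longest element leaves none.
    obtain ⟨j, hj, hmax⟩ := (Finset.univ.filter fun j => x j ≠ 0).exists_max_image id (by
      obtain ⟨j, hj⟩ := Function.ne_iff.1 hx0
      exact ⟨j, by simpa using hj⟩)
    have hlt := hS.ker x hker j (by simpa using hj) fun k hk => by
      by_contra hk0
      exact absurd (hmax k (by simpa using hk0)) (not_le.2 hk)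
    exact absurd hlt (not_lt.2 (hl.position_nonneg j))
  · intro k l
    have h0 : subwordStart _ = 0 := hzero.resolve_right (by have := k.2; omega)
    exact hS.pos k l (by omega) (by omega)
  · rw [eq_comm, mul_assoc, QuotientGroup.mk_mul_of_mem _ (mul_mem ht' hv),
      mk_lowerUnipotent_eq_iff]
    exact hg

/-- By `lowerSign_succ`, positivity at the entry (i, i+1) says that S_{i,i+1} ε_i is negative, so S
determines each sign. -/
theorem eq_of_lowerSign_pos {ε ε' : Fin n → ℤˣ} (hε : ∀ i : Fin n, i.val + 1 = n → ε i = 1)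
    (hε' : ∀ i : Fin n, i.val + 1 = n → ε' i = 1) {S : Matrix (Fin n) (Fin n) ℝ}
    (h : ∀ k l : Fin n, 0 < lowerSign ε k * S k l * lowerSign ε l)
    (h' : ∀ k l : Fin n, 0 < lowerSign ε' k * S k l * lowerSign ε' l) : ε = ε' := by
  funext i
  by_cases hi : i.val + 1 = n
  · rw [hε i hi, hε' i hi]
  · have hi' : i.val + 1 < n := by omega
    have key : ∀ η : Fin n → ℤˣ, 0 < lowerSign η i * S i ⟨i.val + 1, hi'⟩ * lowerSign η (i.val + 1)
        → S i ⟨i.val + 1, hi'⟩ * ((η i : ℤ) : ℝ) < 0 := by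
      intro η hη
      rw [lowerSign_succ] at hη
      linear_combination hη - S i ⟨i.val + 1, hi'⟩ * ((η i : ℤ) : ℝ) * lowerSign_mul_self η i
    have h1 := key ε (h i ⟨i.val + 1, hi'⟩)
    have h2 := key ε' (h' i ⟨i.val + 1, hi'⟩)
    rcases Int.units_eq_one_or (ε i) with e | e <;> rcases Int.units_eq_one_or (ε' i) with e' | e'
      <;> rw [e, e'] <;> simp [e, e'] at h1 h2 <;> linarith

theorem totPos_pairwiseDisjoint : (pinningFamily n).PairwiseDisjoint PinningData.totPos := by
  rintro _ ⟨ε, hε, rfl⟩ _ ⟨ε', hε', rfl⟩ hne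
  refine Set.disjoint_left.2 fun x hx hx' => hne ?_
  obtain ⟨S, hS, -, hpos, rfl⟩ := exists_of_mem_totPos hε hx
  obtain ⟨S', hS', -, hpos', hSS'⟩ := exists_of_mem_totPos hε' hx'
  obtain rfl := mk_lowerUnipotent_injective hSS'
  rw [eq_of_lowerSign_pos hε hε' hpos hpos']

theorem iUnion_totPos_subset : (⋃ P ∈ pinningFamily n, P.totPos) ⊆ thetaPos n := by
  refine Set.iUnion₂_subset ?_
  rintro _ ⟨ε, hε, rfl⟩ x hx
  obtain ⟨S, hS, hdef, -, rfl⟩ := exists_of_mem_totPos hε hx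
  exact mk_lowerUnipotent_mem_thetaPos hS hdef

theorem iUnion_totPos_ne (hn : 2 ≤ n) : (⋃ P ∈ pinningFamily n, P.totPos) ≠ thetaPos n := by
  intro h
  have hmem := mk_lowerUnipotent_mem_thetaPos (n := n) Matrix.transpose_one PosDef.one
  rw [← h] at hmem
  simp only [Set.mem_iUnion] at hmem
  obtain ⟨_, ⟨ε, hε, rfl⟩, hx⟩ := hmem
  obtain ⟨S, hS, -, hpos, hSS'⟩ := exists_of_mem_totPos hε hx
  obtain rfl := mk_lowerUnipotent_injective hSS'
  have := hpos ⟨0, by omega⟩ ⟨1, by omega⟩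
  rw [Matrix.one_apply_ne (by simp)] at this
  simp at this

/-! ### The theta nonnegative part contains the totally nonnegative parts -/

theorem continuous_blockA : Continuous (blockA : Sp n → _) :=
  continuous_matrix fun i j => continuous_subtype_val.matrix_elem (Sum.inl i) (Sum.inl j)

theorem continuous_blockC : Continuous (blockC : Sp n → _) :=
  continuous_matrix fun i j => continuous_subtype_val.matrix_elem (Sum.inr i) (Sum.inl j)

theorem exists_eq_mul_of_mk_eq {g h : Sp n} (e : (g : LG n) = (h : LG n)) :
    ∃ p ∈ parabolic n, h = g * p := ⟨g⁻¹ * h, QuotientGroup.eq.1 e, by group⟩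

/-- A closed subset of the group that is invariant under `P_J⁺` has a closed image. -/
theorem isClosed_orbit {s : Set (Sp n)} (hs : IsClosed s)
    (hinv : ∀ g ∈ s, ∀ p ∈ parabolic n, g * p ∈ s) : IsClosed (orbit s) := by
  rw [← (QuotientGroup.isQuotientMap_mk (N := parabolic n)).isClosed_preimage]
  convert hs using 1
  ext g
  constructor
  · rintro ⟨h, hh, e⟩
    obtain ⟨p, hp, rfl⟩ := exists_eq_mul_of_mk_eq e
    exact hinv h hh p hp
  · exact fun hg => ⟨g, hg, rfl⟩

theorem isClosed_posSemidef : IsClosed {M : Matrix (Fin n) (Fin n) ℝ | M.PosSemidef} := by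
  simp only [posSemidef_iff_dotProduct_mulVec, IsHermitian, Set.ofPred_and, Set.ofPred_forall]
  refine IsClosed.inter (isClosed_eq (by fun_prop) (by fun_prop))
    (isClosed_iInter fun x => isClosed_le continuous_const ?_)
  fun_prop

theorem isClosed_thetaNonneg : IsClosed (thetaNonneg n) := by
  refine isClosed_orbit ?_ ?_
  · exact isClosed_posSemidef.preimage
      (continuous_blockA.matrix_transpose.matrix_mul continuous_blockC)
  · intro g hg p hp
    have hg' : ((blockA g)ᵀ * blockC g).PosSemidef := hg
    have hp' : blockC p = 0 := hp
    change ((blockA (g * p))ᵀ * blockC (g * p)).PosSemidef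
    rw [blockA_mul, blockC_mul, hp']
    simpa [Matrix.mul_assoc] using hg'.conjTranspose_mul_mul_same (blockA p)

/-- The matrix AᵀC does not change, since the diagonal blocks of `h` satisfy AᵀD = 1. -/
theorem posSemidef_mul_of_blockDiagonal {h g : Sp n} (hB : blockB h = 0) (hC : blockC h = 0)
    (hg : ((blockA g)ᵀ * blockC g).PosSemidef) :
    ((blockA (h * g))ᵀ * blockC (h * g)).PosSemidef := by
  have hrel := block_relation h
  rw [hC, Matrix.transpose_zero, Matrix.zero_mul, sub_zero] at hrel
  rw [blockA_mul, blockC_mul, hB, hC, Matrix.zero_mul, Matrix.zero_mul, add_zero, zero_add,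
    Matrix.transpose_mul, Matrix.mul_assoc, ← Matrix.mul_assoc _ (blockD h), hrel, Matrix.one_mul]
  exact hg

/-- Only the last generator changes AᵀC, by the semidefinite term a Cᵀ E_{nn} C (for `yStd`, a Aᵀ
E_{nn} A). -/
theorem posSemidef_xStd_mul {i : Fin n} {a : ℝ} (ha : i.val + 1 = n → 0 ≤ a) {g : Sp n}
    (hg : ((blockA g)ᵀ * blockC g).PosSemidef) :
    ((blockA (xStd i a * g))ᵀ * blockC (xStd i a * g)).PosSemidef := by
  by_cases hi : i.val + 1 < n
  · obtain ⟨-, h2, h3, -⟩ := blocks_of_coe_eq (coe_xStd_of_lt hi a)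
    exact posSemidef_mul_of_blockDiagonal h2 h3 hg
  · obtain ⟨h1, h2, h3, h4⟩ := blocks_of_coe_eq (coe_xStd_of_not_lt hi a)
    rw [blockA_mul, blockC_mul, h1, h2, h3, h4]
    simpa [Matrix.add_mul] using hg.add
      ((posSemidef_single i (ha (by omega))).conjTranspose_mul_mul_same (blockC g))

theorem posSemidef_yStd_mul {i : Fin n} {a : ℝ} (ha : i.val + 1 = n → 0 ≤ a) {g : Sp n}
    (hg : ((blockA g)ᵀ * blockC g).PosSemidef) :
    ((blockA (yStd i a * g))ᵀ * blockC (yStd i a * g)).PosSemidef := by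
  by_cases hi : i.val + 1 < n
  · obtain ⟨-, h2, h3, -⟩ := blocks_of_coe_eq (coe_yStd_of_lt hi a)
    exact posSemidef_mul_of_blockDiagonal h2 h3 hg
  · obtain ⟨h1, h2, h3, h4⟩ := blocks_of_coe_eq (coe_yStd_of_not_lt hi a)
    rw [blockA_mul, blockC_mul, h1, h2, h3, h4]
    simpa [Matrix.mul_add, Matrix.mul_assoc, add_comm] using hg.add
      ((posSemidef_single i (ha (by omega))).conjTranspose_mul_mul_same (blockA g))

theorem iUnion_totNonneg_subset : (⋃ P ∈ pinningFamily n, P.totNonneg) ⊆ thetaNonneg n := by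
  refine Set.iUnion₂_subset ?_
  rintro _ ⟨ε, hε, rfl⟩
  refine closure_minimal (Set.image_mono fun g hg => ?_) isClosed_thetaNonneg
  change ((blockA g)ᵀ * blockC g).PosSemidef
  have hsign : ∀ (i : Fin n) (a : ℝ), 0 < a → i.val + 1 = n → 0 ≤ ((ε i : ℤ) : ℝ) * a := by
    intro i a ha hi
    simpa [hε i hi] using ha.le
  induction hg using Submonoid.closure_induction_left with
  | one => simpa [blockA_one, blockC_one] using PosSemidef.zero
  | mul_left x hx y hy ih =>
    rcases hx with (⟨i, a, ha, rfl⟩ | ⟨i, a, ha, rfl⟩) | hx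
    · exact posSemidef_xStd_mul (hsign i a ha) ih
    · exact posSemidef_yStd_mul (hsign i a ha) ih
    · have hd : x.1.IsDiag := cocharValues_subset _ hx
      refine posSemidef_mul_of_blockDiagonal ?_ ?_ ih
      · ext i j; exact hd (by simp)
      · ext i j; exact hd (by simp)

/-! ### Density of the theta positive part -/

/-- If Ax = -tCx, then 0 ≤ xᵀAᵀCx = -t|Cx|², so Cx = 0 and Ax = 0. The columns of a symplectic
matrix are independent, hence x = 0. -/
theorem isUnit_blockA_add_smul {g : Sp n} (hg : ((blockA g)ᵀ * blockC g).PosSemidef) {t : ℝ}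
    (ht : 0 < t) : IsUnit (blockA g + t • blockC g) := by
  rw [← Matrix.mulVec_injective_iff_isUnit]
  refine (injective_iff_map_eq_zero (Matrix.mulVecLin (blockA g + t • blockC g))).2 fun x hx => ?_
  have hx' : blockA g *ᵥ x = -(t • blockC g *ᵥ x) := by
    rw [mulVecLin_apply, Matrix.add_mulVec, smul_mulVec] at hx
    exact eq_neg_of_add_eq_zero_left hx
  have h1 := hg.dotProduct_mulVec_nonneg x
  have hC : blockC g *ᵥ x = 0 := by
    rw [← Matrix.mulVec_mulVec, star_trivial, Matrix.dotProduct_mulVec,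
      Matrix.vecMul_transpose, hx', neg_dotProduct, smul_dotProduct, smul_eq_mul] at h1
    have h2 : 0 ≤ (blockC g *ᵥ x) ⬝ᵥ (blockC g *ᵥ x) := by
      simpa using dotProduct_star_self_nonneg (blockC g *ᵥ x)
    have h3 : (blockC g *ᵥ x) ⬝ᵥ (blockC g *ᵥ x) = 0 := by nlinarith
    exact dotProduct_self_eq_zero.1 h3
  rw [hC, smul_zero, neg_zero] at hx'
  have hrel := congrArg Matrix.transpose (block_relation g)
  rw [Matrix.transpose_sub, Matrix.transpose_mul, Matrix.transpose_mul, Matrix.transpose_transpose,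
    Matrix.transpose_transpose, Matrix.transpose_one] at hrel
  rw [← Matrix.one_mulVec x, ← hrel, Matrix.sub_mulVec, ← Matrix.mulVec_mulVec,
    ← Matrix.mulVec_mulVec, hx', hC, Matrix.mulVec_zero, Matrix.mulVec_zero, sub_zero]

/-- With A' = A + tC, the matrix A'ᵀC = AᵀC + tCᵀC is semidefinite; congruence by the inverse of A'
makes C A'⁻¹ semidefinite, and adding t makes it definite. -/
theorem exists_posDef_of_posSemidef {g : Sp n} (hg : ((blockA g)ᵀ * blockC g).PosSemidef) {t : ℝ}
    (ht : 0 < t) : ∃ S : Matrix (Fin n) (Fin n) ℝ, S.PosDef ∧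
      blockC g + t • (blockA g + t • blockC g) = S * (blockA g + t • blockC g) := by
  have hu := isUnit_blockA_add_smul hg ht
  have hpsd : ((blockA g + t • blockC g)ᵀ * blockC g).PosSemidef := by
    have := hg.add ((posSemidef_conjTranspose_mul_self (blockC g)).smul ht.le)
    simpa [Matrix.add_mul] using this
  set A := blockA g + t • blockC g
  have hdet : IsUnit A.det := (Matrix.isUnit_iff_isUnit_det A).1 hu
  have hS : (blockC g * A⁻¹).PosSemidef := by
    have := hpsd.conjTranspose_mul_mul_same A⁻¹
    rwa [conjTranspose_eq_transpose_of_trivial, ← Matrix.mul_assoc, ← Matrix.transpose_mul,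
      Matrix.mul_nonsing_inv A hdet, Matrix.transpose_one, Matrix.one_mul] at this
  refine ⟨blockC g * A⁻¹ + t • 1, PosDef.posSemidef_add hS (PosDef.one.smul ht), ?_⟩
  rw [Matrix.add_mul, Matrix.mul_assoc, Matrix.nonsing_inv_mul A hdet]
  simp

open Topology Filter in
theorem thetaNonneg_subset_closure_thetaPos : thetaNonneg n ⊆ closure (thetaPos n) := by
  rintro _ ⟨g, hg, rfl⟩
  have hsymm : ∀ t : ℝ, (t • 1 : Matrix (Fin n) (Fin n) ℝ)ᵀ = t • 1 := by simp
  -- The upper factor makes the top block invertible, the lower one makes the graph positive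
  -- definite; both tend to the identity as t → 0.
  set γ : ℝ → LG n := fun t =>
    ((lowerUnipotent (t • 1) (hsymm t) * upperUnipotent (t • 1) (hsymm t) * g : Sp n) : LG n)
  have hcont : Continuous γ := by
    refine continuous_quotient_mk'.comp ((Continuous.mul ?_ ?_).mul continuous_const)
    · exact Continuous.subtype_mk (by fun_prop) _
    · exact Continuous.subtype_mk (by fun_prop) _
  have hγ0 : γ 0 = (g : LG n) := by
    have h1 : lowerUnipotent ((0 : ℝ) • 1) (hsymm 0) = (1 : Sp n) := by
      ext1; simp [lowerUnipotent]
    have h2 : upperUnipotent ((0 : ℝ) • 1) (hsymm 0) = (1 : Sp n) := by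
      ext1; simp [upperUnipotent]
    simp only [γ, h1, h2, one_mul]
  refine mem_closure_of_tendsto (f := γ) (b := 𝓝[>] 0) ?_ ?_
  · rw [← hγ0]
    exact hcont.continuousAt.tendsto.mono_left nhdsWithin_le_nhds
  · filter_upwards [self_mem_nhdsWithin] with t ht
    obtain ⟨S, hS, hSA⟩ := exists_posDef_of_posSemidef hg ht
    have hSs : Sᵀ = S := by simpa using hS.isHermitian.eq
    have : γ t = (lowerUnipotent S hSs : LG n) := by
      obtain ⟨h1, h2, h3, h4⟩ := blocks_of_coe_eq (g := lowerUnipotent (t • 1) (hsymm t)) rfl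
      obtain ⟨k1, k2, k3, k4⟩ := blocks_of_coe_eq (g := upperUnipotent (t • 1) (hsymm t)) rfl
      rw [eq_comm, mk_lowerUnipotent_eq_iff, mul_assoc, blockA_mul, blockC_mul, blockA_mul,
        blockC_mul, h1, h2, h3, h4, k1, k2, k3, k4]
      simpa [add_comm] using hSA
    rw [this]
    exact mk_lowerUnipotent_mem_thetaPos hSs hS

/-! ### The case `n = 2` -/

theorem isClosed_iUnion_totNonneg : IsClosed (⋃ P ∈ pinningFamily n, P.totNonneg) := by
  have hfin : (pinningFamily n).Finite := by
    refine (Set.finite_range (signedPinning (n := n))).subset ?_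
    rintro _ ⟨ε, -, rfl⟩
    exact ⟨ε, rfl⟩
  exact hfin.isClosed_biUnion fun P _ => isClosed_closure

theorem transpose_symm_two (p q r : ℝ) : (!![p, q; q, r] : Matrix (Fin 2) (Fin 2) ℝ)ᵀ =
    !![p, q; q, r] := by
  ext i j; fin_cases i <;> fin_cases j <;> rfl

theorem mk_lowerUnipotent_mem_iUnion_totNonneg {p q r : ℝ} (hp : 0 < p) (hq : q ≠ 0)
    (hpq : q * q < p * r) :
    (lowerUnipotent !![p, q; q, r] (transpose_symm_two p q r) : LG 2) ∈
      ⋃ P ∈ pinningFamily 2, P.totNonneg := by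
  obtain ⟨u, hu⟩ : ∃ u : ℤˣ, 0 < ((u : ℤ) : ℝ) * (-p / q) := by
    rcases lt_or_gt_of_ne hq with h | h
    · exact ⟨1, by simpa using div_pos_of_neg_of_neg (neg_lt_zero.2 hp) h⟩
    · exact ⟨-1, by simpa [neg_div] using div_pos hp h⟩
  set ε : Fin 2 → ℤˣ := ![u, 1] with hε
  have hmem : signedPinning ε ∈ pinningFamily 2 := by
    refine ⟨ε, fun i hi => ?_, rfl⟩
    have : i = 1 := Fin.ext (by simpa using hi)
    rw [this]; rfl
  -- The letter `y_2(q²/p)` creates the entry q²/p, the congruence with coefficient p/q spreads it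
  -- to the rank one matrix with entries p, q, q²/p, and the last factor corrects the lower corner
  -- to r. The sign `u` makes the middle parameter positive.
  refine Set.mem_biUnion hmem (subset_closure ⟨(signedPinning ε).y 1 (r - q * q / p) *
    ((signedPinning ε).y 0 (((u : ℤ) : ℝ) * (-p / q)) * (signedPinning ε).y 1 (q * q / p)), ?_, ?_⟩)
  · have hy : ∀ i (a : ℝ), 0 < a → (signedPinning ε).y i a ∈ (signedPinning ε).groupNonneg :=
      fun i a ha => Submonoid.subset_closure (Or.inl (Or.inr ⟨i, a, ha, rfl⟩))
    refine mul_mem (hy _ _ ?_) (mul_mem (hy _ _ hu) (hy _ _ ?_))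
    · rw [sub_pos, div_lt_iff₀ hp]; linarith
    · exact div_pos (mul_self_pos.2 hq) hp
  · have hy1 : ∀ a : ℝ, (signedPinning ε).y 1 a = yStd 1 a := fun a => by
      simp [signedPinning, hε]
    have hy0 : (signedPinning ε).y 0 (((u : ℤ) : ℝ) * (-p / q)) = yStd 0 (-p / q) := by
      simp [signedPinning, hε, ← mul_assoc, sign_mul_self]
    rw [hy1, hy1, hy0, eq_comm, mk_lowerUnipotent_eq_iff]
    obtain ⟨h1, h2, h3, h4⟩ := blocks_of_coe_eq
      (coe_yStd_of_lt (i := (0 : Fin 2)) (by simp) (-p / q))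
    obtain ⟨k1, -, k3, -⟩ := blocks_of_coe_eq
      (coe_yStd_of_not_lt (i := (1 : Fin 2)) (by simp) (q * q / p))
    obtain ⟨l1, l2, l3, l4⟩ := blocks_of_coe_eq
      (coe_yStd_of_not_lt (i := (1 : Fin 2)) (by simp) (r - q * q / p))
    simp only [blockC_mul, blockA_mul, h1, h2, h3, h4, k1, k3, l1, l2, l3, l4]
    ext i j
    fin_cases i <;> fin_cases j <;>
      simp [transvection, Matrix.mul_apply, Fin.sum_univ_two, single_apply, one_apply] <;>
      field_simp <;> ring

open Topology Filter in
theorem thetaNonneg_two_subset : thetaNonneg 2 ⊆ ⋃ P ∈ pinningFamily 2, P.totNonneg := by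
  refine thetaNonneg_subset_closure_thetaPos.trans
    (closure_minimal ?_ isClosed_iUnion_totNonneg)
  rintro _ ⟨g, ⟨S, hS, hg⟩, rfl⟩
  have hSs : Sᵀ = S := by simpa using hS.isHermitian.eq
  obtain ⟨p, q, r, rfl⟩ : ∃ p q r : ℝ, S = !![p, q; q, r] := by
    refine ⟨S 0 0, S 0 1, S 1 1, ?_⟩
    have := congrFun (congrFun hSs 0) 1
    rw [Matrix.transpose_apply] at this
    ext i j; fin_cases i <;> fin_cases j <;> simp [this]
  obtain rfl : g = lowerUnipotent _ hSs := Subtype.ext hg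
  have hp : 0 < p := by simpa using hS.diag_pos (i := 0)
  have hr : 0 < r := by simpa using hS.diag_pos (i := 1)
  have hdet : q * q < p * r := by
    have := hS.det_pos
    rw [det_fin_two] at this
    simpa using this
  by_cases hq : q = 0
  · subst hq
    -- A diagonal matrix is a limit of definite ones with off-diagonal entry t ≠ 0. The union is
    -- closed, so the sign of t is irrelevant.
    set γ : ℝ → LG 2 := fun t => (lowerUnipotent _ (transpose_symm_two p t r) : LG 2)
    have hcont : Continuous γ := by
      refine continuous_quotient_mk'.comp (Continuous.subtype_mk ?_ _)
      fun_prop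
    refine isClosed_iUnion_totNonneg.mem_of_tendsto (f := γ) (b := 𝓝[≠] 0)
      (hcont.continuousAt.tendsto.mono_left nhdsWithin_le_nhds) ?_
    have hsmall : ∀ᶠ t : ℝ in 𝓝[≠] 0, t * t < p * r :=
      ((continuous_id.mul continuous_id).continuousAt.eventually_lt continuousAt_const
        (by simpa using hdet)).filter_mono nhdsWithin_le_nhds
    filter_upwards [hsmall, self_mem_nhdsWithin] with t ht ht0
    exact mk_lowerUnipotent_mem_iUnion_totNonneg hp ht0 ht
  · exact mk_lowerUnipotent_mem_iUnion_totNonneg hp hq hdet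

/-! ### Plücker coordinates -/

/-- All maximal minors are nonnegative, the rows being ordered by `position`. -/
def MinorsNonneg (M : Matrix (Fin n ⊕ Fin n) (Fin n) ℝ) : Prop :=
  ∀ f : Fin n → Fin n ⊕ Fin n, StrictMono (position ∘ f) → 0 ≤ (M.submatrix f id).det

/-- A minor is linear in row p, so it gains c times the minor with row q in place of row p. That
minor has a repeated row or, because p and q are adjacent, its rows are still in increasing order.
-/
theorem MinorsNonneg.transvection_mul {M : Matrix (Fin n ⊕ Fin n) (Fin n) ℝ} (hM : MinorsNonneg M)
    {p q : Fin n ⊕ Fin n} (hpq : position q = position p + 1 ∨ position p = position q + 1)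
    {c : ℝ} (hc : 0 ≤ c) : MinorsNonneg (transvection p q c * M) := by
  intro f hf
  have hinj : Function.Injective f := hf.injective.of_comp
  by_cases hp : ∃ t, f t = p
  · obtain ⟨t, rfl⟩ := hp
    have h1 : (transvection (f t) q c * M).submatrix f id =
        (M.submatrix f id).updateRow t (M (f t) + c • M q) := by
      ext s j
      rcases eq_or_ne s t with rfl | hs
      · simp [transvection_mul_apply_same]
      · simp [hs, transvection_mul_apply_of_ne _ _ _ _ (hinj.ne hs)]
    have h2 : (M.submatrix f id).updateRow t (M (f t)) = M.submatrix f id :=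
      updateRow_eq_self _ t
    have h3 : (M.submatrix f id).updateRow t (M q) = M.submatrix (Function.update f t q) id := by
      ext s j
      rcases eq_or_ne s t with rfl | hs
      · simp
      · simp [hs]
    rw [h1, det_updateRow_add, det_updateRow_smul, h2, h3]
    refine add_nonneg (hM f hf) (mul_nonneg hc ?_)
    by_cases hq : ∃ s, f s = q
    · obtain ⟨s, rfl⟩ := hq
      have hst : s ≠ t := by rintro rfl; omega
      rw [det_zero_of_row_eq hst]
      ext j
      simp [hst]
    · have hq' : ∀ s, position (f s) ≠ position q := fun s e => hq ⟨s, position_injective e⟩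
      refine hM _ fun a b hab => ?_
      have hab' : position (f a) < position (f b) := hf hab
      have ha := hq' a
      have hb := hq' b
      rcases eq_or_ne a t with hat | hat <;> rcases eq_or_ne b t with hbt | hbt
      · exact absurd (hat.trans hbt.symm) hab.ne
      · subst hat
        simp only [Function.comp, Function.update_self, Function.update_of_ne hbt]
        omega
      · subst hbt
        simp only [Function.comp, Function.update_self, Function.update_of_ne hat]
        omega
      · simpa only [Function.comp, Function.update_of_ne hat, Function.update_of_ne hbt] using hab'
  · have h1 : (transvection p q c * M).submatrix f id = M.submatrix f id := by
      ext s j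
      simp [transvection_mul_apply_of_ne _ _ _ _ fun h => hp ⟨s, h⟩]
    rw [h1]
    exact hM f hf

theorem MinorsNonneg.diagonal_mul {M : Matrix (Fin n ⊕ Fin n) (Fin n) ℝ} (hM : MinorsNonneg M)
    {d : Fin n ⊕ Fin n → ℝ} (hd : ∀ x, 0 ≤ d x) : MinorsNonneg (diagonal d * M) := by
  intro f hf
  have h1 : (diagonal d * M).submatrix f id = diagonal (d ∘ f) * M.submatrix f id := by
    ext s j
    simp [Matrix.diagonal_mul]
  rw [h1, det_mul, det_diagonal]
  exact mul_nonneg (Finset.prod_nonneg fun s _ => hd _) (hM f hf)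

/-- The signs by which the basis vectors are changed for the signs `ε` of a pinning. -/
def basisSign (ε : Fin n → ℤˣ) : Fin n ⊕ Fin n → ℝ :=
  Sum.elim (fun k => cumSign ε k) fun k => lowerSign ε k

theorem basisSign_mul_self (ε : Fin n → ℤˣ) (x : Fin n ⊕ Fin n) :
    basisSign ε x * basisSign ε x = 1 := by
  rcases x with k | k
  · exact cumSign_mul_self ε k
  · exact lowerSign_mul_self ε k

theorem diagonal_basisSign_mul_self (ε : Fin n → ℤˣ) :
    diagonal (basisSign ε) * diagonal (basisSign ε) = 1 := by
  simp [diagonal_mul_diagonal, basisSign_mul_self]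

theorem diagonal_cumSign_mul_self (ε : Fin n → ℤˣ) :
    (diagonal (fun k : Fin n => cumSign ε k) * diagonal (fun k : Fin n => cumSign ε k) :
      Matrix (Fin n) (Fin n) ℝ) = 1 := by
  simp [diagonal_mul_diagonal, cumSign_mul_self]

theorem diagonal_mul_transvection_mul (ε : Fin n → ℤˣ) (p q : Fin n ⊕ Fin n) (c : ℝ) :
    diagonal (basisSign ε) * transvection p q c * diagonal (basisSign ε) =
      transvection p q (basisSign ε p * c * basisSign ε q) := by
  rw [transvection, Matrix.mul_add, Matrix.add_mul, Matrix.mul_one, diagonal_basisSign_mul_self,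
    transvection]
  congr 1
  ext x y
  rw [Matrix.mul_diagonal, Matrix.diagonal_mul, single_apply, single_apply]
  split_ifs with h
  · rw [h.1, h.2]
  · simp

theorem coe_xStd_eq_mul {i : Fin n} (h : i.val + 1 < n) (a : ℝ) : (xStd i a).1 =
    transvection (Sum.inl i) (Sum.inl ⟨i.val + 1, h⟩) a *
      transvection (Sum.inr ⟨i.val + 1, h⟩) (Sum.inr i) (-a) := by
  have h1 : ∀ (j k : Fin n) (c : ℝ), transvection (Sum.inl j) (Sum.inl k) c =
      fromBlocks (transvection j k c) 0 0 (1 : Matrix (Fin n) (Fin n) ℝ) := by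
    intro j k c
    ext (s | s) (t | t) <;> simp [transvection, single_apply, one_apply]
  have h2 : ∀ (j k : Fin n) (c : ℝ), transvection (Sum.inr j) (Sum.inr k) c =
      fromBlocks (1 : Matrix (Fin n) (Fin n) ℝ) 0 0 (transvection j k c) := by
    intro j k c
    ext (s | s) (t | t) <;> simp [transvection, single_apply, one_apply]
  rw [coe_xStd_of_lt h, h1, h2, fromBlocks_multiply]
  simp

theorem coe_xStd_eq_transvection {i : Fin n} (h : ¬ i.val + 1 < n) (a : ℝ) : (xStd i a).1 =
    transvection (Sum.inl i) (Sum.inr i) a := by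
  rw [coe_xStd_of_not_lt h]
  ext (s | s) (t | t) <;> simp [transvection, single_apply, one_apply]

/-- The operators that preserve nonnegativity of maximal minors, after the sign change. -/
def PreservesMinors (ε : Fin n → ℤˣ) (h : Sp n) : Prop :=
  ∀ M : Matrix (Fin n ⊕ Fin n) (Fin n) ℝ, MinorsNonneg M →
    MinorsNonneg (diagonal (basisSign ε) * h.1 * diagonal (basisSign ε) * M)

/-- In the signed basis both transvections that make up a generator have the same positive
coefficient. -/
theorem basisSign_lt {ε : Fin n → ℤˣ} {i : Fin n} (h : i.val + 1 < n) (a : ℝ) :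
    basisSign ε (Sum.inl i) * (((ε i : ℤ) : ℝ) * a) * basisSign ε (Sum.inl ⟨i.val + 1, h⟩) = a ∧
    basisSign ε (Sum.inr ⟨i.val + 1, h⟩) * -(((ε i : ℤ) : ℝ) * a) * basisSign ε (Sum.inr i)
      = a := by
  have h1 := cumSign_succ ε i
  have h2 := lowerSign_succ ε i
  simp only [basisSign, Sum.elim_inl, Sum.elim_inr]
  have h3 := cumSign_mul_self ε i
  have h4 := lowerSign_mul_self ε i
  have h5 := sign_mul_self (ε i)
  constructor
  · rw [h1]
    linear_combination a * ((ε i : ℤ) : ℝ) * ((ε i : ℤ) : ℝ) * h3 + a * h5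
  · rw [h2]
    linear_combination a * ((ε i : ℤ) : ℝ) * ((ε i : ℤ) : ℝ) * h4 + a * h5

/-- The exponent in `lowerSign` is even at the last index, so the last generator keeps its sign. -/
theorem basisSign_last {ε : Fin n → ℤˣ} {i : Fin n} (h : i.val + 1 = n) :
    basisSign ε (Sum.inl i) * basisSign ε (Sum.inr i) = 1 := by
  simp only [basisSign, Sum.elim_inl, Sum.elim_inr, lowerSign]
  rw [show n + 1 + i.val = 2 * n by omega, pow_mul]
  simp [cumSign_mul_self]

theorem diagonal_mul_mul_mul_diagonal (ε : Fin n → ℤˣ)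
    (X Y : Matrix (Fin n ⊕ Fin n) (Fin n ⊕ Fin n) ℝ) :
    diagonal (basisSign ε) * (X * Y) * diagonal (basisSign ε) =
      (diagonal (basisSign ε) * X * diagonal (basisSign ε)) *
        (diagonal (basisSign ε) * Y * diagonal (basisSign ε)) := by
  rw [Matrix.mul_assoc (_ * X), Matrix.mul_assoc (diagonal _) Y, ← Matrix.mul_assoc (diagonal _)
    (diagonal _), diagonal_basisSign_mul_self, Matrix.one_mul]
  simp only [Matrix.mul_assoc]

theorem preservesMinors_xStd (ε : Fin n → ℤˣ) (hε : ∀ i : Fin n, i.val + 1 = n → ε i = 1)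
    (i : Fin n) {a : ℝ} (ha : 0 < a) : PreservesMinors ε (xStd i (((ε i : ℤ) : ℝ) * a)) := by
  intro M hM
  by_cases hi : i.val + 1 < n
  · rw [coe_xStd_eq_mul hi, diagonal_mul_mul_mul_diagonal, diagonal_mul_transvection_mul,
      diagonal_mul_transvection_mul, (basisSign_lt hi a).1, (basisSign_lt hi a).2, Matrix.mul_assoc]
    refine (hM.transvection_mul ?_ ha.le).transvection_mul ?_ ha.le <;> simp <;> omega
  · have hi' : i.val + 1 = n := by omega
    rw [coe_xStd_eq_transvection hi, diagonal_mul_transvection_mul, mul_right_comm,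
      basisSign_last hi', hε i hi']
    refine hM.transvection_mul ?_ (by simpa using ha.le)
    simp; omega

theorem preservesMinors_yStd (ε : Fin n → ℤˣ) (hε : ∀ i : Fin n, i.val + 1 = n → ε i = 1)
    (i : Fin n) {a : ℝ} (ha : 0 < a) : PreservesMinors ε (yStd i (((ε i : ℤ) : ℝ) * a)) := by
  intro M hM
  change MinorsNonneg (diagonal (basisSign ε) * (xStd i (((ε i : ℤ) : ℝ) * a)).1ᵀ *
    diagonal (basisSign ε) * M)
  by_cases hi : i.val + 1 < n
  · rw [coe_xStd_eq_mul hi, Matrix.transpose_mul, transvection_transpose, transvection_transpose,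
      diagonal_mul_mul_mul_diagonal, diagonal_mul_transvection_mul,
      diagonal_mul_transvection_mul, mul_right_comm, mul_comm (basisSign ε (Sum.inr i)),
      mul_right_comm (basisSign ε (Sum.inr _)), (basisSign_lt hi a).2, mul_right_comm,
      mul_comm (basisSign ε (Sum.inl _)), mul_right_comm (basisSign ε (Sum.inl _)),
      (basisSign_lt hi a).1, Matrix.mul_assoc]
    refine (hM.transvection_mul ?_ ha.le).transvection_mul ?_ ha.le <;> simp <;> omega
  · have hi' : i.val + 1 = n := by omega
    rw [coe_xStd_eq_transvection hi, transvection_transpose, diagonal_mul_transvection_mul,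
      mul_right_comm, mul_comm (basisSign ε (Sum.inr i)), basisSign_last hi', hε i hi']
    refine hM.transvection_mul ?_ (by simpa using ha.le)
    simp; omega

theorem preservesMinors_of_mem_cocharValues (ε : Fin n → ℤˣ) {g : Sp n}
    (hg : g ∈ cocharValues (torus n)) : PreservesMinors ε g := by
  obtain ⟨χ, hχ, c, hc, rfl⟩ := hg
  intro M hM
  -- Writing c as a square makes χ(c) the square of a diagonal matrix, so its entries are
  -- nonnegative.
  obtain ⟨b, hb⟩ : ∃ b : ℝˣ, b * b = c :=
    ⟨Units.mk0 (Real.sqrt c) (Real.sqrt_pos.2 hc).ne', Units.ext (Real.mul_self_sqrt hc.le)⟩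
  have hdiag : (χ b).1.IsDiag := hχ.1 b
  have h1 : (χ c).1 = diagonal fun x => (χ b).1 x x * (χ b).1 x x := by
    rw [← hb, map_mul, Submonoid.coe_mul, ← (isDiag_iff_diagonal_diag _).1 hdiag,
      diagonal_mul_diagonal]
    simp
  rw [h1, diagonal_mul_diagonal, diagonal_mul_diagonal]
  refine hM.diagonal_mul fun x => ?_
  rw [mul_right_comm, basisSign_mul_self, one_mul]
  exact mul_self_nonneg _

/-- The first `n` columns, with the sign change of rows and columns. -/
def signedColumns (ε : Fin n → ℤˣ) (g : Sp n) : Matrix (Fin n ⊕ Fin n) (Fin n) ℝ :=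
  diagonal (basisSign ε) * g.1.submatrix id Sum.inl * diagonal fun k : Fin n => cumSign ε k

theorem signedColumns_apply (ε : Fin n → ℤˣ) (g : Sp n) (x : Fin n ⊕ Fin n) (j : Fin n) :
    signedColumns ε g x j = basisSign ε x * g.1 x (Sum.inl j) * cumSign ε j := by
  simp [signedColumns, Matrix.diagonal_mul, Matrix.mul_diagonal]

theorem signedColumns_mul (ε : Fin n → ℤˣ) (h g : Sp n) : signedColumns ε (h * g) =
    diagonal (basisSign ε) * h.1 * diagonal (basisSign ε) * signedColumns ε g := by
  have h1 : (h * g).1.submatrix id Sum.inl = h.1 * g.1.submatrix id Sum.inl := rfl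
  rw [signedColumns, signedColumns, h1, Matrix.mul_assoc (_ * h.1) (diagonal _),
    ← Matrix.mul_assoc (diagonal _) _ (diagonal _), ← Matrix.mul_assoc (diagonal _) (diagonal _),
    diagonal_basisSign_mul_self, Matrix.one_mul]
  simp only [Matrix.mul_assoc]

theorem signedColumns_mul_of_mem (ε : Fin n → ℤˣ) (g : Sp n) {p : Sp n} (hp : p ∈ parabolic n) :
    ∃ a : Matrix (Fin n) (Fin n) ℝ, signedColumns ε (g * p) = signedColumns ε g * a := by
  have hC : blockC p = 0 := hp
  have h1 : (g * p).1.submatrix id Sum.inl = g.1.submatrix id Sum.inl * blockA p := by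
    ext x j
    have : ∀ k, p.1 (Sum.inr k) (Sum.inl j) = 0 := fun k => congrFun (congrFun hC k) j
    simp [Matrix.mul_apply, Fintype.sum_sum_type, this, blockA, toBlocks₁₁]
  refine ⟨diagonal (fun k : Fin n => cumSign ε k) * blockA p * diagonal fun k : Fin n => cumSign ε k, ?_⟩
  rw [signedColumns, signedColumns, h1, Matrix.mul_assoc _ (diagonal _) (_ * _),
    Matrix.mul_assoc (diagonal _) (blockA p), ← Matrix.mul_assoc (diagonal _) (diagonal _),
    diagonal_cumSign_mul_self, Matrix.one_mul]
  simp only [Matrix.mul_assoc]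

/-- Any minor using a lower row is zero, and the only other one is the determinant of the identity,
thanks to the sign change of the columns. -/
theorem minorsNonneg_signedColumns_one (ε : Fin n → ℤˣ) :
    MinorsNonneg (signedColumns ε (1 : Sp n)) := by
  intro f hf
  by_cases hinr : ∃ s k, f s = Sum.inr k
  · obtain ⟨s, k, hs⟩ := hinr
    rw [det_eq_zero_of_row_eq_zero s]
    intro j
    simp [signedColumns_apply, hs]
  · have hinl : ∀ s, ∃ k, f s = Sum.inl k := by
      intro s
      rcases hfs : f s with k | k
      · exact ⟨k, rfl⟩
      · exact absurd ⟨s, k, hfs⟩ hinr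
    choose φ hφ using hinl
    have hmono : StrictMono φ := fun a b hab => by
      have := hf hab
      simpa [hφ] using this
    have hid : ∀ s, φ s = s := by
      refine congrFun ((hmono.range_inj strictMono_id).1 ?_)
      rw [(Finite.surjective_of_injective hmono.injective).range_eq, Set.range_id]
    have : (signedColumns ε (1 : Sp n)).submatrix f id = 1 := by
      ext s j
      rw [submatrix_apply, signedColumns_apply, hφ, hid]
      by_cases hsj : s = j
      · subst hsj; simp [basisSign, cumSign_mul_self]
      · simp [hsj]
    rw [this, det_one]
    exact zero_le_one

/-- The elements all of whose (sign changed) Plücker coordinates have the same sign. -/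
def pluckerSet (ε : Fin n → ℤˣ) : Set (Sp n) :=
  {g | (∀ f : Fin n → Fin n ⊕ Fin n, StrictMono (position ∘ f) →
      0 ≤ ((signedColumns ε g).submatrix f id).det) ∨
    ∀ f : Fin n → Fin n ⊕ Fin n, StrictMono (position ∘ f) →
      ((signedColumns ε g).submatrix f id).det ≤ 0}

/-- Another representative of the coset multiplies all minors by one common determinant, which may
be negative; hence the two alternatives in `pluckerSet`. -/
theorem mul_mem_pluckerSet {ε : Fin n → ℤˣ} {g p : Sp n} (hg : g ∈ pluckerSet ε)
    (hp : p ∈ parabolic n) : g * p ∈ pluckerSet ε := by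
  obtain ⟨a, ha⟩ := signedColumns_mul_of_mem ε g hp
  have hdet : ∀ f : Fin n → Fin n ⊕ Fin n, ((signedColumns ε (g * p)).submatrix f id).det =
      ((signedColumns ε g).submatrix f id).det * a.det := by
    intro f
    rw [ha, ← det_mul]
    rfl
  simp only [pluckerSet, Set.mem_ofPred_eq, hdet]
  rcases le_total 0 a.det with h | h <;> rcases hg with hg | hg
  · exact Or.inl fun f hf => mul_nonneg (hg f hf) h
  · exact Or.inr fun f hf => mul_nonpos_of_nonpos_of_nonneg (hg f hf) h
  · exact Or.inr fun f hf => mul_nonpos_of_nonneg_of_nonpos (hg f hf) h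
  · exact Or.inl fun f hf => mul_nonneg_of_nonpos_of_nonpos (hg f hf) h

theorem isClosed_pluckerSet (ε : Fin n → ℤˣ) : IsClosed (pluckerSet ε) := by
  have hcont : ∀ f : Fin n → Fin n ⊕ Fin n,
      Continuous fun g : Sp n => ((signedColumns ε g).submatrix f id).det := by
    intro f
    refine Continuous.matrix_det (continuous_matrix fun i j => ?_)
    simp only [submatrix_apply, signedColumns_apply]
    exact (continuous_const.mul (continuous_subtype_val.matrix_elem _ _)).mul continuous_const
  simp only [pluckerSet, Set.ofPred_or, Set.ofPred_forall]
  exact IsClosed.union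
    (isClosed_iInter fun f => isClosed_iInter fun _ => isClosed_le continuous_const (hcont f))
    (isClosed_iInter fun f => isClosed_iInter fun _ => isClosed_le (hcont f) continuous_const)

theorem totNonneg_subset_orbit_pluckerSet (ε : Fin n → ℤˣ)
    (hε : ∀ i : Fin n, i.val + 1 = n → ε i = 1) :
    (signedPinning ε).totNonneg ⊆ orbit (pluckerSet ε) := by
  refine closure_minimal (Set.image_mono fun g hg => Or.inl ?_)
    (isClosed_orbit (isClosed_pluckerSet ε) fun g hg p hp => mul_mem_pluckerSet hg hp)
  change MinorsNonneg (signedColumns ε g)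
  induction hg using Submonoid.closure_induction_left with
  | one => exact minorsNonneg_signedColumns_one ε
  | mul_left x hx y hy ih =>
    rw [signedColumns_mul]
    rcases hx with (⟨i, a, ha, rfl⟩ | ⟨i, a, ha, rfl⟩) | hx
    · exact preservesMinors_xStd ε hε i ha _ ih
    · exact preservesMinors_yStd ε hε i ha _ ih
    · exact preservesMinors_of_mem_cocharValues ε hx _ ih

/-! ### The case `n ≥ 3` -/

/-- The rows `1, …, n` without `i`, followed by the row `-k`. -/
def replaceRow {m : ℕ} (i k : Fin (m + 1)) : Fin (m + 1) → Fin (m + 1) ⊕ Fin (m + 1) :=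
  Fin.lastCases (Sum.inr k) fun j => Sum.inl (i.succAbove j)

theorem strictMono_replaceRow {m : ℕ} (i k : Fin (m + 1)) :
    StrictMono (position ∘ replaceRow i k) := by
  intro a b hab
  induction a using Fin.lastCases with
  | last => exact absurd hab (not_lt.2 (Fin.le_last b))
  | cast a =>
    induction b using Fin.lastCases with
    | last =>
      simp only [Function.comp, replaceRow, Fin.lastCases_castSucc, Fin.lastCases_last,
        position_inl, position_inr]
      omega
    | cast b =>
      have : i.succAbove a < i.succAbove b := Fin.strictMono_succAbove i (by simpa using hab)
      simpa [Function.comp, replaceRow] using this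

/-- All rows but the last are unit vectors, and they miss only column `i`. Expansion along the last
row leaves that single entry. -/
theorem det_signedColumns_replaceRow {m : ℕ} (ε : Fin (m + 1) → ℤˣ)
    (S : Matrix (Fin (m + 1)) (Fin (m + 1)) ℝ) (hS : Sᵀ = S) (i k : Fin (m + 1)) :
    ((signedColumns ε (lowerUnipotent S hS)).submatrix (replaceRow i k) id).det =
      (-1) ^ (m + i.val) * (lowerSign ε k * S k i * cumSign ε i) := by
  have hlast : ∀ j, (signedColumns ε (lowerUnipotent S hS)).submatrix (replaceRow i k) id
      (Fin.last m) j = lowerSign ε k * S k j * cumSign ε j := by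
    intro j
    simp [signedColumns_apply, replaceRow, basisSign, lowerUnipotent]
  have hcast : ∀ a j, (signedColumns ε (lowerUnipotent S hS)).submatrix (replaceRow i k) id
      (Fin.castSucc a) j = if i.succAbove a = j then 1 else 0 := by
    intro a j
    simp only [signedColumns_apply, replaceRow, basisSign, lowerUnipotent, submatrix_apply,
      Fin.lastCases_castSucc, fromBlocks_apply₁₁, Sum.elim_inl, one_apply, id]
    split_ifs with h
    · rw [← h, mul_one, cumSign_mul_self]
    · simp
  rw [det_succ_row _ (Fin.last m), Finset.sum_eq_single i]
  · have h1 : ((signedColumns ε (lowerUnipotent S hS)).submatrix (replaceRow i k) id).submatrix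
        (Fin.last m).succAbove i.succAbove = 1 := by
      ext a b
      rw [submatrix_apply, Fin.succAbove_last, hcast, one_apply]
      simp
    rw [h1, det_one, hlast, mul_one, Fin.val_last]
  · intro j _ hji
    obtain ⟨b, hb⟩ := Fin.exists_succAbove_eq hji.symm
    rw [det_eq_zero_of_column_eq_zero b, mul_zero]
    intro a
    rw [submatrix_apply, Fin.succAbove_last, hcast, hb, if_neg (Fin.succAbove_ne i a)]
  · simp

/-- Two minors that omit the same row `i` carry the same factor from the expansion and from
`cumSign`, which cancels in their product. -/
theorem lowerUnipotent_mem_pluckerSet {m : ℕ} {ε : Fin (m + 1) → ℤˣ}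
    {S : Matrix (Fin (m + 1)) (Fin (m + 1)) ℝ} {hS : Sᵀ = S}
    (h : (lowerUnipotent S hS : LG (m + 1)) ∈ orbit (pluckerSet ε)) (i k l : Fin (m + 1)) :
    0 ≤ (lowerSign ε k * S k i) * (lowerSign ε l * S l i) := by
  obtain ⟨g, hg, e⟩ := h
  obtain ⟨p, hp, hgp⟩ := exists_eq_mul_of_mk_eq e
  have hmem : lowerUnipotent S hS ∈ pluckerSet ε := hgp ▸ mul_mem_pluckerSet hg hp
  have hprod : 0 ≤ ((-1) ^ (m + i.val) * (lowerSign ε k * S k i * cumSign ε i)) *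
      ((-1) ^ (m + i.val) * (lowerSign ε l * S l i * cumSign ε i)) := by
    rw [← det_signedColumns_replaceRow ε S hS i k, ← det_signedColumns_replaceRow ε S hS i l]
    rcases hmem with h | h
    · exact mul_nonneg (h _ (strictMono_replaceRow i k)) (h _ (strictMono_replaceRow i l))
    · exact mul_nonneg_of_nonpos_of_nonpos (h _ (strictMono_replaceRow i k))
        (h _ (strictMono_replaceRow i l))
  have hs : ((-1 : ℝ) ^ (m + i.val)) * (-1) ^ (m + i.val) = 1 := by rw [← mul_pow]; simp
  have hc := cumSign_mul_self ε i
  rwa [show ((-1) ^ (m + i.val) * (lowerSign ε k * S k i * cumSign ε i)) *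
      ((-1) ^ (m + i.val) * (lowerSign ε l * S l i * cumSign ε i)) =
      ((-1 : ℝ) ^ (m + i.val) * (-1) ^ (m + i.val)) * (cumSign ε i * cumSign ε i) *
        ((lowerSign ε k * S k i) * (lowerSign ε l * S l i)) by ring, hs, hc, one_mul, one_mul]
    at hprod

/-- This is the Cauchy–Schwarz inequality (∑ x_i)² ≤ n ∑ x_i². -/
theorem posSemidef_smul_one_sub_ones (n : ℕ) :
    ((n : ℝ) • 1 - Matrix.of fun _ _ => 1 : Matrix (Fin n) (Fin n) ℝ).PosSemidef := by
  rw [posSemidef_iff_dotProduct_mulVec]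
  refine ⟨?_, fun x => ?_⟩
  · ext i j; simp [one_apply, eq_comm]
  · have hx : star x ⬝ᵥ (((n : ℝ) • 1 - Matrix.of fun _ _ => 1 : Matrix (Fin n) (Fin n) ℝ) *ᵥ x) =
        n * ∑ i, x i ^ 2 - (∑ i, x i) ^ 2 := by
      have h1 : (Matrix.of fun _ _ => 1 : Matrix (Fin n) (Fin n) ℝ) *ᵥ x = fun _ => ∑ i, x i := by
        ext i; simp [mulVec, dotProduct]
      rw [Matrix.sub_mulVec, h1, smul_mulVec, one_mulVec, dotProduct_sub, dotProduct_smul]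
      simp only [star_trivial, dotProduct, ← Finset.sum_mul, smul_eq_mul]
      simp only [sq]
    rw [hx]
    have := sq_sum_le_card_mul_sum_sq (s := Finset.univ) (f := x)
    simp only [Finset.card_univ, Fintype.card_fin] at this
    linarith

theorem iUnion_totNonneg_ne (hn : 3 ≤ n) : (⋃ P ∈ pinningFamily n, P.totNonneg) ≠ thetaNonneg n := by
  obtain ⟨m, rfl⟩ : ∃ m, n = m + 1 := ⟨n - 1, by omega⟩
  intro h
  have hpsd := posSemidef_smul_one_sub_ones (m + 1)
  set S : Matrix (Fin (m + 1)) (Fin (m + 1)) ℝ := ((m + 1 : ℕ) : ℝ) • 1 - Matrix.of fun _ _ => 1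
    with hSdef
  have hS : Sᵀ = S := by simpa using hpsd.isHermitian.eq
  have hmem : (lowerUnipotent S hS : LG (m + 1)) ∈ thetaNonneg (m + 1) := by
    refine ⟨_, ?_, rfl⟩
    obtain ⟨h1, -, h3, -⟩ := blocks_of_coe_eq (g := lowerUnipotent S hS) rfl
    change (_ᵀ * _ : Matrix _ _ ℝ).PosSemidef
    rw [h1, h3]
    simpa using hpsd
  rw [← h] at hmem
  simp only [Set.mem_iUnion] at hmem
  obtain ⟨_, ⟨ε, hε, rfl⟩, hx⟩ := hmem
  have hx' := totNonneg_subset_orbit_pluckerSet ε hε hx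
  have hoff : ∀ k l : Fin (m + 1), k ≠ l → S k l = -1 := fun k l hkl => by
    simp [hSdef, one_apply_ne hkl]
  have hdiag : ∀ k : Fin (m + 1), S k k = m := fun k => by simp [hSdef]
  have h01 : (⟨0, by omega⟩ : Fin (m + 1)) ≠ ⟨1, by omega⟩ := by simp
  have h02 : (⟨0, by omega⟩ : Fin (m + 1)) ≠ ⟨2, by omega⟩ := by simp
  have h12 : (⟨1, by omega⟩ : Fin (m + 1)) ≠ ⟨2, by omega⟩ := by simp
  -- Rows 0 and 1 have entries of opposite signs in column 0 but of equal signs in column 2, so the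
  -- product of their two signs would be both nonpositive and nonnegative, though its square is 1.
  have h1 := lowerUnipotent_mem_pluckerSet hx' ⟨0, by omega⟩ ⟨0, by omega⟩ ⟨1, by omega⟩
  have h2 := lowerUnipotent_mem_pluckerSet hx' ⟨2, by omega⟩ ⟨0, by omega⟩ ⟨1, by omega⟩
  rw [hdiag, hoff _ _ h01.symm] at h1
  rw [hoff _ _ h02, hoff _ _ h12] at h2
  have hm : (2 : ℝ) ≤ m := by exact_mod_cast (by omega : 2 ≤ m)
  have e0 := lowerSign_mul_self ε 0
  have e1 := lowerSign_mul_self ε 1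
  simp only at h1 h2
  set u := lowerSign ε 0
  set v := lowerSign ε 1
  have h3 : 0 ≤ u * v := by linarith
  have h4 : (u * v) * (u * v) = 1 := by linear_combination v * v * e0 + e1
  have h5 : 0 ≤ -(m * (u * v)) := by linarith
  nlinarith

end LagGr

end

theorem mainTheorem8 (n : ℕ) (hn : 1 ≤ n) :
    -- the totally positive parts are pairwise disjoint, and their union lies in `𝒫_{>0}`,
    -- strictly as soon as there is a simple root subgroup of type `A`
    ((LagGr.pinningFamily n).PairwiseDisjoint LagGr.PinningData.totPos ∧
      (⋃ P ∈ LagGr.pinningFamily n, P.totPos) ⊆ LagGr.thetaPos n ∧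
      (2 ≤ n → (⋃ P ∈ LagGr.pinningFamily n, P.totPos) ≠ LagGr.thetaPos n)) ∧
    -- the union of the totally nonnegative parts lies in `𝒫_{≥0}`
    (⋃ P ∈ LagGr.pinningFamily n, P.totNonneg) ⊆ LagGr.thetaNonneg n ∧
    (n = 2 → (⋃ P ∈ LagGr.pinningFamily n, P.totNonneg) = LagGr.thetaNonneg n) ∧
    (3 ≤ n → (⋃ P ∈ LagGr.pinningFamily n, P.totNonneg) ≠ LagGr.thetaNonneg n) := by
  refine ⟨⟨LagGr.totPos_pairwiseDisjoint, LagGr.iUnion_totPos_subset, LagGr.iUnion_totPos_ne⟩,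
    LagGr.iUnion_totNonneg_subset, ?_, LagGr.iUnion_totNonneg_ne⟩
  rintro rfl
  exact LagGr.iUnion_totNonneg_subset.antisymm LagGr.thetaNonneg_two_subset
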